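/- **Setting.** Let $FIN(\mathbb N)$ be the additive monoid of finitely supported vectors $\mathbf m:\mathbb N\to\mathbb Z_+$, where $\mathbb N=\{1,2,\dots\}$, with the pointwise order. A *label* is a set $\mathcal M\subset FIN(\mathbb N)$ such that $\mathbf m'\le\mathbf m\in\mathcal M$ implies $\mathbf m'\in\mathcal M$. Labels carry the topology of the ultrametric $d(\mathcal M_1,\mathcal M_2)=\inf\{2^{-N}:\mathcal M_1\cap\mathcal B_N=\mathcal M_2\cap\mathcal B_N\}$, where $\mathcal B_N$ is the set of vectors with entries $\le N$ and support in $[1,N]$. Put $P_{\mathbf r}(\mathcal M)=\mathcal M-\mathbf r=\{\mathbf w\in FIN(\mathbb N):\mathbf w+\mathbf r\in\mathcal M\}$, let $\Theta(\mathcal M)$ be the closure of $\{\mathcal M-\mathbf r:\mathbf r\in FIN(\mathbb N)\}$, and let $\mathcal E(\Theta(\mathcal M))$ be the closure of $\{P_{\mathbf r}|\Theta(\mathcal M):\mathbf r\in FIN(\mathbb N)\}$ in $\Theta(\mathcal M)^{\Theta(\mathcal M)}$ for pointwise convergence. A label $\mathcal M$ is *simple* if it is bounded (there is $\mu:\mathbb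 N\to\mathbb Z_+$ with $\mathbf m\le\mu$ for all $\mathbf m\in\mathcal M$) and, whenever $\mathbf r^i\in\mathcal M$ is a sequence such that $\{\mathcal M-\mathbf r^i\}$ converges, its limit is $\mathcal M-\mathbf r$ for some $\mathbf r\in FIN(\mathbb N)$. Fix an integer $b\ge 3$ and $k:\mathbb Z\to\mathbb Z$ with $k(-n)=-k(n)$ for all $n$, $k(n+1)>b\sum_{i=0}^n k(i)$ for $n\ge 0$, and $k(1)\ge b+1$ (e.g. $b=3$ and $k(n)=\operatorname{sgn}(n)4^{|n|}$). Fix a partition $\{D_\ell\}_{\ell\in\mathbb N}$ of $\mathbb N$ into infinite sets with $\min D_\ell<\min D_{\ell+1}$, and let $\ell(n)$ be the index with $n\in D_{\ell(n)}$. An *expansion* of $t\in\mathbb Z$ is a finite sequence of nonzero integers $j_1,\dots,j_r$ with $|j_1|>\dots>|j_r|$ and $t=k(j_1)+\dots+k(j_r)$ (it is unique if it exists); it is *positive* if all $j_i>0$. Its length vector is $\mathbf r(t)=\sum_i\chi(\ell(|j_i|))$, where $\chi(\ell)$ is the $\ell$-th unit vector. Let $A[\mathcal M]$ be the set of $t$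 that have an expansion with $\mathbf r(t)\in\mathcal M$, let $A_+[\mathcal M]$ be its intersection with the set of sums of finite subsets of $k(\mathbb Z_+)$, and let $x[\mathcal M],x_+[\mathcal M]\in\{0,1\}^{\mathbb Z}$ be the characteristic functions of $A[\mathcal M]$ and $A_+[\mathcal M]$. Let $S$ be the shift, $(Sx)_t=x_{t+1}$, and let $X(\mathcal M)$ and $X_+(\mathcal M)$ be the $S$-orbit closures of $x[\mathcal M]$ and $x_+[\mathcal M]$. The enveloping semigroup $E(X,S)$ is the closure of $\{S^n:n\in\mathbb Z\}$ in $X^X$ for pointwise convergence, and $(X,S)$ is *WAP* if all elements of $E(X,S)$ are continuous maps. **Theorem.** Let $\mathcal M$ be a simple label. Then $(X(\mathcal M),S)$ and $(X_+(\mathcal M),S)$ are countable WAP subshifts. The semigroups $\mathcal E(\Theta(\mathcal M))$, $E(X(\mathcal M),S)$ and $E(X_+(\mathcal M),S)$ are abelian, and their elements are continuous maps on $\Theta(\mathcal M)$, $X(\mathcal M)$ and $X_+(\mathcal M)$, respectively. For each $\mathbf r\in FIN(\mathbb N)$ there is a unique $p_{\mathbf r}\in E(X(\mathcal M),S)$ with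 $p_{\mathbf r}x[\mathcal M]=x[\mathcal M-\mathbf r]$, and it is the pointwise limit of $S^{t^i}$ for every sequence $\{t^i\}$ of integers that have expansions such that the smallest absolute value of a term of the expansion of $t^i$ tends to $\infty$ (the empty expansion imposes no condition) and eventually $\mathcal M-\mathbf r(t^i)=\mathcal M-\mathbf r$. There is a continuous injective homomorphism of monoids $J_{\mathcal M}:\mathcal E(\Theta(\mathcal M))\to E(X(\mathcal M),S)$ such that $x[\mathcal N]\in X(\mathcal M)$ and $J_{\mathcal M}(Q)x[\mathcal N]=x[Q(\mathcal N)]$ for all $Q\in\mathcal E(\Theta(\mathcal M))$ and $\mathcal N\in\Theta(\mathcal M)$, and such that $J_{\mathcal M}(P_{\mathbf r})=p_{\mathbf r}$ for all $\mathbf r$. Every element of $E(X(\mathcal M),S)$ is of the form $S^np_{\mathbf r}=S^nJ_{\mathcal M}(P_{\mathbf r})$ with $n\in\mathbb Z$ and $\mathbf r\in FIN(\mathbb N)$. The statements of the last paragraph also hold with $X_+(\mathcal M)$, $x_+[\cdot]$, $J_{+\mathcal M}$ and the corresponding elements $p_{\mathbf r}\in E(X_+(\mathcal M),S)$ in place of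 $X(\mathcal M)$, $x[\cdot]$, $J_{\mathcal M}$ and $p_{\mathbf r}$, where the expansions of the times $t^i$ are now required to be positive. -/

import Mathlib

open Filter Topology

namespace LabeledSubshift

/-! ### Dynamical systems, orbit closures and enveloping semigroups

A `Γ`-system (for an additive monoid `Γ`) is a topological space `X` with an additive action of `Γ`
by continuous maps, the action being written `γ +ᵥ x`. -/

section Systems

variable (Γ : Type*) {X : Type*} [AddMonoid Γ] [AddAction Γ X] [TopologicalSpace X]

/-- The closure of the `Γ`-orbit of `x`. -/
def orbitClosure (x : X) : Set X :=
  closure (Set.range fun γ : Γ => γ +ᵥ x)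

theorem self_mem_orbitClosure (x : X) : x ∈ orbitClosure Γ x :=
  subset_closure ⟨0, zero_vadd Γ x⟩

variable {Γ} in
theorem vadd_mem_orbitClosure [ContinuousConstVAdd Γ X] {x y : X} (γ : Γ)
    (hy : y ∈ orbitClosure Γ x) : γ +ᵥ y ∈ orbitClosure Γ x := by
  refine map_mem_closure (continuous_const_vadd γ) hy ?_
  rintro _ ⟨δ, rfl⟩
  exact ⟨γ + δ, add_vadd γ δ x⟩

/-- `Γ` acts on the orbit closure of a point. -/
instance orbitClosureAction [ContinuousConstVAdd Γ X] (x : X) :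
    AddAction Γ (orbitClosure Γ x) where
  vadd γ y := ⟨γ +ᵥ (y : X), vadd_mem_orbitClosure γ y.2⟩
  zero_vadd y := Subtype.ext (zero_vadd Γ (y : X))
  add_vadd γ δ y := Subtype.ext (add_vadd γ δ (y : X))

instance orbitClosureContinuous [ContinuousConstVAdd Γ X] (x : X) :
    ContinuousConstVAdd Γ (orbitClosure Γ x) where
  continuous_const_vadd γ :=
    Continuous.subtype_mk ((continuous_const_vadd γ).comp continuous_subtype_val) _

variable (X) in
/-- The enveloping semigroup `E(X, Γ)`: the closure of the maps `x ↦ γ +ᵥ x` in the space of all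
maps `X → X` with the topology of pointwise convergence. -/
def Enveloping : Type _ :=
  {p : X → X // p ∈ closure (Set.range fun (γ : Γ) (x : X) => γ +ᵥ x)}

namespace Enveloping

instance : TopologicalSpace (Enveloping Γ X) :=
  inferInstanceAs (TopologicalSpace
    {p : X → X // p ∈ closure (Set.range fun (γ : Γ) (x : X) => γ +ᵥ x)})

instance : CoeFun (Enveloping Γ X) (fun _ => X → X) := ⟨Subtype.val⟩

variable {Γ}

/-- The element of the enveloping semigroup given by `γ`. -/
def of (γ : Γ) : Enveloping Γ X := ⟨fun x => γ +ᵥ x, subset_closure ⟨γ, rfl⟩⟩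

theorem comp_mem [ContinuousConstVAdd Γ X] (p q : Enveloping Γ X) :
    (p : X → X) ∘ (q : X → X) ∈ closure (Set.range fun (γ : Γ) (x : X) => γ +ᵥ x) := by
  have h1 : ∀ γ : Γ, (fun x => γ +ᵥ q x) ∈
      closure (Set.range fun (γ : Γ) (x : X) => γ +ᵥ x) := by
    intro γ
    refine map_mem_closure (f := fun (f : X → X) (x : X) => γ +ᵥ f x) ?_ q.2 ?_
    · exact continuous_pi fun x => (continuous_const_vadd γ).comp (continuous_apply x)
    · rintro _ ⟨δ, rfl⟩
      exact ⟨γ + δ, funext fun x => add_vadd γ δ x⟩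
  have h2 : (p : X → X) ∘ (q : X → X) ∈
      closure (closure (Set.range fun (γ : Γ) (x : X) => γ +ᵥ x)) := by
    refine map_mem_closure (f := fun (f : X → X) => f ∘ (q : X → X)) ?_ p.2 ?_
    · exact continuous_pi fun x => continuous_apply (q x)
    · rintro _ ⟨δ, rfl⟩
      exact h1 δ
  rwa [closure_closure] at h2

/-- The product of the enveloping semigroup is composition of maps. -/
instance [ContinuousConstVAdd Γ X] : Monoid (Enveloping Γ X) where
  mul p q := ⟨(p : X → X) ∘ (q : X → X), comp_mem p q⟩
  one := ⟨id, subset_closure ⟨0, funext fun x => zero_vadd Γ x⟩⟩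
  mul_assoc _ _ _ := rfl
  one_mul _ := rfl
  mul_one _ := rfl

end Enveloping

variable (X) in
/-- The system is WAP: every element of its enveloping semigroup is a continuous map. -/
def IsWAP : Prop := ∀ p : Enveloping Γ X, Continuous (p : X → X)

end Systems

/-! ### The space of labels -/

/-- `FIN(ℕ)`: the finitely supported vectors with non-negative integer entries, indexed by the
positive integers, with the pointwise order. -/
abbrev FIN : Type := ℕ+ →₀ ℕ

/-- A label: a set of vectors in `FIN(ℕ)` that is closed under passing to smaller vectors. -/
@[ext] structure Label where
  carrier : Set FIN
  heredity : ∀ m ∈ carrier, ∀ m' ≤ m, m' ∈ carrier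

namespace Label

instance : Membership FIN Label := ⟨fun M m => m ∈ M.carrier⟩

/-- The topology on labels in which `M i → N` iff for each vector `m` eventually
`m ∈ M i ↔ m ∈ N`; see `nhds_hasBasis` for the description by the sets `box N`. -/
noncomputable instance : TopologicalSpace Label :=
  TopologicalSpace.induced (fun M : Label => M.carrier.boolIndicator) inferInstance

/-- The finite set of vectors with all entries at most `N` and support in `[1, N]`. -/
def box (N : ℕ) : Set FIN := {m | ∀ l : ℕ+, m l ≤ N ∧ (N < (l : ℕ) → m l = 0)}

theorem box_finite (N : ℕ) : (box N).Finite := by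
  classical
  have hfin : {l : ℕ+ | (l : ℕ) ≤ N}.Finite :=
    (Set.finite_Iic N).preimage (fun a _ b _ h => PNat.coe_injective h)
  refine (Set.finite_Iic (Finsupp.onFinset hfin.toFinset
    (fun l => if (l : ℕ) ≤ N then N else 0) ?_)).subset ?_
  · intro l hl
    rw [Set.Finite.mem_toFinset]
    change (l : ℕ) ≤ N
    by_contra hlt
    simp [hlt] at hl
  · intro m hm l
    simp only [Finsupp.onFinset_apply]
    split_ifs with h
    · exact (hm l).1
    · exact ((hm l).2 (not_le.mp h)).le

theorem exists_subset_box (s : Finset FIN) : ∃ N, (s : Set FIN) ⊆ box N := by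
  refine ⟨s.sup fun m => m.support.sup fun l => m l + (l : ℕ), fun m hm l => ?_⟩
  by_cases hl : m l = 0
  · simp [hl]
  · have h1 : m l + (l : ℕ) ≤ m.support.sup fun l => m l + (l : ℕ) :=
      Finset.le_sup (f := fun l => m l + (l : ℕ)) (Finsupp.mem_support_iff.mpr hl)
    have h2 : (m.support.sup fun l => m l + (l : ℕ)) ≤
        s.sup fun m => m.support.sup fun l => m l + (l : ℕ) :=
      Finset.le_sup (f := fun m : FIN => m.support.sup fun l => m l + (l : ℕ)) hm
    constructor
    · omega
    · intro h; omega

theorem boolIndicator_eq_iff {A B : Set FIN} {m : FIN} :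
    A.boolIndicator m = B.boolIndicator m ↔ (m ∈ A ↔ m ∈ B) := by
  classical
  by_cases hA : m ∈ A <;> by_cases hB : m ∈ B <;> simp [Set.boolIndicator, hA, hB]

/-- The topology is the one of the ultrametric
`d(M₁, M₂) = inf {2 ^ (-N) | M₁ ∩ box N = M₂ ∩ box N}`. -/
theorem nhds_hasBasis (M : Label) :
    (𝓝 M).HasBasis (fun _ : ℕ => True)
      (fun N => {M' : Label | ∀ m ∈ box N, m ∈ M' ↔ m ∈ M}) := by
  refine ⟨fun t => ?_⟩
  rw [nhds_induced, mem_comap]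
  constructor
  · rintro ⟨u, hu, hut⟩
    rw [nhds_pi, Filter.mem_pi'] at hu
    obtain ⟨s, v, hv, hvu⟩ := hu
    obtain ⟨N, hN⟩ := exists_subset_box s
    refine ⟨N, trivial, fun M' hM' => hut (hvu fun m hm => ?_)⟩
    have h := boolIndicator_eq_iff.mpr (hM' m (hN hm))
    change M'.carrier.boolIndicator m ∈ v m
    rw [show M'.carrier.boolIndicator m = M.carrier.boolIndicator m from h]
    exact mem_of_mem_nhds (hv m)
  · rintro ⟨N, -, hN⟩
    refine ⟨(box N).pi fun m => ({M.carrier.boolIndicator m} : Set Bool), ?_,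
      fun M' hM' => hN ?_⟩
    · exact set_pi_mem_nhds (box_finite N) fun m _ => by simp
    · exact fun m hm => boolIndicator_eq_iff.mp (hM' m hm)

/-- `M - r`, the set of `w` with `w + r ∈ M`. -/
def minus (M : Label) (r : FIN) : Label where
  carrier := {w | w + r ∈ M}
  heredity _ hm _ hle := M.heredity _ hm _ (add_le_add_left hle r)

/-- The action of the monoid `FIN(ℕ)` on the space of labels, in which `r` acts by the map
`P_r : M ↦ M - r`; thus `r +ᵥ M = M - r`. -/
instance : AddAction FIN Label where
  vadd r M := M.minus r
  zero_vadd M := by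
    ext w
    change w + 0 ∈ M.carrier ↔ _
    rw [add_zero]
  add_vadd r s M := by
    ext w
    change w + (r + s) ∈ M.carrier ↔ w + r + s ∈ M.carrier
    rw [add_assoc]

instance : ContinuousConstVAdd FIN Label where
  continuous_const_vadd r := by
    refine continuous_induced_rng.mpr (continuous_pi fun w => ?_)
    have h : Continuous fun M : Label => M.carrier.boolIndicator := continuous_induced_dom
    exact (continuous_apply (w + r)).comp h

/-- A label is bounded if its vectors are all dominated by one `μ : ℕ → ℤ₊`. -/
def IsBounded (M : Label) : Prop := ∃ μ : ℕ+ → ℕ, ∀ m ∈ M, ∀ l, m l ≤ μ l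

/-- A label `M` is simple if it is bounded and every limit of a convergent sequence `M - r i`
with all `r i ∈ M` is of the form `M - s`. -/
def IsSimple (M : Label) : Prop :=
  M.IsBounded ∧ ∀ r : ℕ → FIN, (∀ i, r i ∈ M) → ∀ N : Label,
    Tendsto (fun i => M.minus (r i)) atTop (𝓝 N) → ∃ s : FIN, N = M.minus s

/-- `Θ(M)`: the closure of the set of labels `M - r`, that is, the `FIN(ℕ)`-orbit closure. -/
abbrev Theta (M : Label) : Set Label := orbitClosure FIN M

end Label

/-! ### Expanding functions and labeled integers -/

/-- `k` is a `b`-expanding function on `ℤ`: it is odd and `k (n + 1) > b * ∑_{i ≤ n} k i`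
for `n ≥ 0`. -/
def IsExpandingFunction (b : ℕ) (k : ℤ → ℤ) : Prop :=
  (∀ n, k (-n) = -k n) ∧
    ∀ n : ℕ, (b : ℤ) * ∑ i ∈ Finset.range (n + 1), k (i : ℤ) < k ((n : ℤ) + 1)

/-- A numbered partition of the positive integers into infinite sets `D l`, given by its support
map `ell` (so that `D l = {n | ell n = l}`), with `min (D l) < min (D (l + 1))`. -/
def IsSupportMap (ell : ℕ+ → ℕ+) : Prop :=
  (∀ l, {n | ell n = l}.Infinite) ∧
    ∀ l a a', IsLeast {n | ell n = l} a → IsLeast {n | ell n = l + 1} a' → a < a'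

/-- `j` is an expansion: a finite sequence of nonzero integers with strictly decreasing absolute
values. -/
def IsExpansion (j : List ℤ) : Prop :=
  j.Pairwise (fun a a' => |a'| < |a|) ∧ ∀ a ∈ j, a ≠ 0

/-- The integer `k(j₁) + ... + k(j_r)` with expansion `j₁, ..., j_r`. -/
def time (k : ℤ → ℤ) (j : List ℤ) : ℤ := (j.map k).sum

/-- The length vector `χ(ℓ(|j₁|)) + ... + χ(ℓ(|j_r|))` of an expansion. -/
noncomputable def lengthVector (ell : ℕ+ → ℕ+) (j : List ℤ) : FIN :=
  (j.map fun a => Finsupp.single (ell a.natAbs.toPNat') 1).sum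

/-- `IP₊(k)`: the sums of finite subsets of `k(ℤ₊)`. -/
def IPplus (k : ℤ → ℤ) : Set ℤ :=
  {t | ∃ F : Finset ℤ, (F : Set ℤ) ⊆ k '' {n | 0 ≤ n} ∧ t = ∑ a ∈ F, a}

/-- `A[M]`: the integers that have an expansion whose length vector is in `M`. -/
def A (k : ℤ → ℤ) (ell : ℕ+ → ℕ+) (M : Label) : Set ℤ :=
  {t | ∃ j, IsExpansion j ∧ t = time k j ∧ lengthVector ell j ∈ M}

/-- `A₊[M] = A[M] ∩ IP₊(k)`. -/
def Aplus (k : ℤ → ℤ) (ell : ℕ+ → ℕ+) (M : Label) : Set ℤ := A k ell M ∩ IPplus k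

/-! ### Labeled subshifts -/

/-- The shift action of `ℤ` on `{0,1}^ℤ` (with the product topology): `n` acts by `S ^ n`, where
`(S ^ n x)_t = x_{t + n}`. -/
instance : AddAction ℤ (ℤ → Bool) where
  vadd n x := fun t => x (t + n)
  zero_vadd x := funext fun t => congrArg x (add_zero t)
  add_vadd m n x := funext fun t => congrArg x (add_assoc t m n).symm

instance : ContinuousConstVAdd ℤ (ℤ → Bool) where
  continuous_const_vadd n := continuous_pi fun t => continuous_apply (t + n)

/-- `x[M]`, the characteristic function of `A[M]`. -/
noncomputable def labelPoint (k : ℤ → ℤ) (ell : ℕ+ → ℕ+) (M : Label) : ℤ → Bool :=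
  (A k ell M).boolIndicator

/-- `x₊[M]`, the characteristic function of `A₊[M]`. -/
noncomputable def labelPointPlus (k : ℤ → ℤ) (ell : ℕ+ → ℕ+) (M : Label) : ℤ → Bool :=
  (Aplus k ell M).boolIndicator

/-- `X(M)`, the orbit closure of `x[M]` under the shift. -/
abbrev labelShift (k : ℤ → ℤ) (ell : ℕ+ → ℕ+) (M : Label) : Set (ℤ → Bool) :=
  orbitClosure ℤ (labelPoint k ell M)

/-- `X₊(M)`, the orbit closure of `x₊[M]` under the shift. -/
abbrev labelShiftPlus (k : ℤ → ℤ) (ell : ℕ+ → ℕ+) (M : Label) : Set (ℤ → Bool) :=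
  orbitClosure ℤ (labelPointPlus k ell M)

/-- A sequence of expansions `j i` such that the last terms tend to infinity in absolute value
(that is, the smallest absolute value of a term does) and such that `M - r(j i)` is eventually
equal to `M - r`. -/
def Approximates (ell : ℕ+ → ℕ+) (M : Label) (r : FIN) (j : ℕ → List ℤ) : Prop :=
  (∀ i, IsExpansion (j i)) ∧
    (∀ N : ℤ, ∀ᶠ i in atTop, ∀ a ∈ j i, N ≤ |a|) ∧
    ∀ᶠ i in atTop, M.minus (lengthVector ell (j i)) = M.minus r

/-- `p` is the element `p_r` of `E(X(M), S)`: it is the only element which maps `x[M]` to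
`x[M - r]`, and it is the pointwise limit of the maps `S ^ (t i)` for every sequence `t i` of
times with expansions as in `Approximates`. -/
def IsLimitElement (k : ℤ → ℤ) (ell : ℕ+ → ℕ+) (M : Label) (r : FIN)
    (p : Enveloping ℤ (labelShift k ell M)) : Prop :=
  (∀ q : Enveloping ℤ (labelShift k ell M),
    (q ⟨labelPoint k ell M, self_mem_orbitClosure ℤ _⟩ : ℤ → Bool) =
      labelPoint k ell (M.minus r) ↔ q = p) ∧
  ∀ j : ℕ → List ℤ, Approximates ell M r j →
    Tendsto
      (fun i => (Enveloping.of (time k (j i)) : Enveloping ℤ (labelShift k ell M)))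
      atTop (𝓝 p)

/-- `p` is the element `p_r` of `E(X₊(M), S)`: it is the only element which maps `x₊[M]` to
`x₊[M - r]`, and it is the pointwise limit of the maps `S ^ (t i)` for every sequence `t i` of
times with positive expansions as in `Approximates`. -/
def IsLimitElementPlus (k : ℤ → ℤ) (ell : ℕ+ → ℕ+) (M : Label) (r : FIN)
    (p : Enveloping ℤ (labelShiftPlus k ell M)) : Prop :=
  (∀ q : Enveloping ℤ (labelShiftPlus k ell M),
    (q ⟨labelPointPlus k ell M, self_mem_orbitClosure ℤ _⟩ : ℤ → Bool) =
      labelPointPlus k ell (M.minus r) ↔ q = p) ∧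
  ∀ j : ℕ → List ℤ, Approximates ell M r j → (∀ i, ∀ a ∈ j i, 0 < a) →
    Tendsto
      (fun i => (Enveloping.of (time k (j i)) : Enveloping ℤ (labelShiftPlus k ell M)))
      atTop (𝓝 p)

end LabeledSubshift

open LabeledSubshift

namespace LabeledSubshift

/-! ### Labels -/

namespace Label

/-! Simplicity removes all limits outside the orbit: `Θ(M)` consists of the labels `M - s` alone
(`IsSimple.exists_eq_minus`). In any system of a commutative monoid, an element of the enveloping
semigroup commutes with the continuous elements. If the continuous elements carry one point to every
other point, each element is determined by its value at that point, so all elements are continuous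
and commute (`Enveloping.eq_of_apply_eq` and its corollaries). For `Θ(M)` the translations `P_s`
suffice.

For the subshifts, rapid growth of `k` makes the large digits of an expansion readable from an
approximate value of the time. Hence a shift by a time with large digits acts locally as subtraction
of its length vector (`apply_add`). Given arbitrary shifts of coded labels, an ultrafilter separates
the digits that persist from those that escape to infinity. The persistent digits are finite in
number (`finite_of_digitLength_mem`) and give a fixed shift; the escaping ones give a label in
`Θ(M)`. This is `exists_tendsto_vadd`: it shows that every point is `S^n x[M - s]` and that
subtracting `r` from the label is a continuous map `p_r`. The elements `S^n p_s` then carry the base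
point everywhere, and the abstract argument applies again.

Finiteness of the persistent digits rests on a cardinality argument: otherwise simplicity would
inject the reals into the countable set `FIN`. Both subshifts are treated at once through
`IsLabelCoding`. -/

theorem mem_minus {M : Label} {r w : FIN} : w ∈ M.minus r ↔ w + r ∈ M := Iff.rfl

theorem minus_minus (M : Label) (r s : FIN) : (M.minus r).minus s = M.minus (r + s) := by
  ext w
  change w + s + r ∈ M.carrier ↔ w + (r + s) ∈ M.carrier
  rw [add_assoc, add_comm s r]

theorem minus_comm (M : Label) (r s : FIN) :
    (M.minus r).minus s = (M.minus s).minus r := by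
  rw [minus_minus, minus_minus, add_comm]

theorem minus_zero (M : Label) : M.minus 0 = M := zero_vadd FIN M

theorem mem_of_le {M : Label} {m m' : FIN} (hm : m ∈ M) (h : m' ≤ m) : m' ∈ M :=
  M.heredity m hm m' h

theorem minus_subset {M : Label} {r w : FIN} (h : w ∈ M.minus r) : w ∈ M :=
  mem_of_le (mem_minus.mp h) le_self_add

/-- Both sides are the empty label, by heredity. -/
theorem minus_eq_minus_of_notMem {M : Label} {r s : FIN} (hr : r ∉ M) (hs : s ∉ M) :
    M.minus r = M.minus s := by
  ext w
  exact ⟨fun h => absurd (mem_of_le (mem_minus.mp h) le_add_self) hr,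
    fun h => absurd (mem_of_le (mem_minus.mp h) le_add_self) hs⟩

theorem isInducing_boolIndicator :
    IsInducing (fun M : Label => M.carrier.boolIndicator) := ⟨rfl⟩

theorem tendsto_nhds_iff {ι : Type*} {l : Filter ι} {F : ι → Label} {N : Label} :
    Tendsto F l (𝓝 N) ↔ ∀ w, ∀ᶠ i in l, (w ∈ F i ↔ w ∈ N) := by
  rw [isInducing_boolIndicator.tendsto_nhds_iff, tendsto_pi_nhds]
  refine forall_congr' fun w => ?_
  rw [nhds_discrete, tendsto_pure]
  exact eventually_congr (Eventually.of_forall fun i => boolIndicator_eq_iff)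

instance : T2Space Label := by
  refine T2Space.of_injective_continuous (f := fun M : Label => M.carrier.boolIndicator) ?_
    isInducing_boolIndicator.continuous
  intro M N h
  ext w
  exact boolIndicator_eq_iff.mp (congrFun h w)

/-- Points of `Θ(M)` become limits of sequences, which is the form in which simplicity is stated. -/
instance : FirstCountableTopology Label := isInducing_boolIndicator.firstCountableTopology

theorem minus_mem_Theta (M : Label) (s : FIN) : M.minus s ∈ M.Theta := subset_closure ⟨s, rfl⟩

theorem continuous_minus (r : FIN) : Continuous fun M : Label => M.minus r :=
  continuous_const_vadd (T := Label) r

/-- An ultrafilter limit of labels. -/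
theorem exists_tendsto_ultrafilter {ι : Type*} (U : Ultrafilter ι) (F : ι → Label) :
    ∃ N : Label, Tendsto F U (𝓝 N) := by
  refine ⟨⟨{w | ∀ᶠ i in U, w ∈ F i}, fun m hm m' hle => hm.mono fun i hi => mem_of_le hi hle⟩, ?_⟩
  rw [tendsto_nhds_iff]
  intro w
  by_cases h : ∀ᶠ i in (U : Filter ι), w ∈ F i
  · exact h.mono fun i hi => ⟨fun _ => h, fun _ => hi⟩
  · exact (Ultrafilter.eventually_not.mpr h).mono fun i hi =>
      ⟨fun h' => absurd h' hi, fun h' => absurd h' h⟩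

theorem IsBounded.exists_notMem {M : Label} (hM : M.IsBounded) : ∃ s : FIN, s ∉ M := by
  obtain ⟨μ, hμ⟩ := hM
  refine ⟨Finsupp.single 1 (μ 1 + 1), fun h => ?_⟩
  have := hμ _ h 1
  simp at this

theorem IsSimple.exists_eq_minus {M N : Label} (hM : M.IsSimple) (hN : N ∈ M.Theta) :
    ∃ s : FIN, N = M.minus s := by
  obtain ⟨u, hu, hlim⟩ := mem_closure_iff_seq_limit.mp hN
  choose r hr using hu
  obtain rfl : (fun i => M.minus (r i)) = u := funext hr
  by_cases h : ∃ᶠ i in atTop, r i ∈ M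
  · obtain ⟨φ, hφ, hφM⟩ := extraction_of_frequently_atTop h
    exact hM.2 (r ∘ φ) hφM N (hlim.comp hφ.tendsto_atTop)
  -- Here `M - r i` is eventually the empty label, which boundedness represents as `M - s` with `s ∉
  -- M`.
  · obtain ⟨s, hs⟩ := hM.1.exists_notMem
    refine ⟨s, tendsto_nhds_unique hlim ?_⟩
    refine tendsto_const_nhds.congr' ?_
    filter_upwards [not_frequently.mp h] with i hi
    exact minus_eq_minus_of_notMem hs hi

/-- The vectors of a simple label cannot exhaust the indicator function of an infinite set. -/
theorem IsSimple.exists_sum_single_notMem {M : Label} (hM : M.IsSimple) {e : ℚ → ℕ+} :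
    ∃ F : Finset ℚ, (∑ q ∈ F, Finsupp.single (e q) 1 : FIN) ∉ M := by
  by_contra! hF
  let v : Finset ℚ → FIN := fun F => ∑ q ∈ F, Finsupp.single (e q) 1
  have hv_mono : ∀ {F G : Finset ℚ}, F ⊆ G → v F ≤ v G := fun h => Finset.sum_le_sum_of_subset h
  -- `N α` is the limit of `M - v F` as the finite set `F` exhausts the rationals below `α`.
  -- Simplicity writes it as `M - s α`, and the contradiction will be that `s` is injective on the
  -- reals.
  let N : ℝ → Label := fun α =>
    ⟨{w | ∀ F : Finset ℚ, (∀ q ∈ F, (q : ℝ) < α) → w + v F ∈ M},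
      fun m hm m' hle F hFα => mem_of_le (hm F hFα) (add_le_add_left hle _)⟩
  have hN : ∀ α, ∃ s : FIN, N α = M.minus s := by
    intro α
    obtain ⟨f, hf⟩ := exists_surjective_nat ℚ
    let G : ℕ → Finset ℚ := fun n =>
      ((Finset.range n).image f).filter fun q : ℚ => (q : ℝ) < α
    have hG_mono : Monotone G := fun m n h =>
      Finset.filter_subset_filter _ (Finset.image_subset_image (Finset.range_mono h))
    have hGα : ∀ n, ∀ q ∈ G n, (q : ℝ) < α := fun n q hq => (Finset.mem_filter.mp hq).2
    have hG_exh : ∀ F : Finset ℚ, (∀ q ∈ F, (q : ℝ) < α) → ∃ n, F ⊆ G n := by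
      intro F hFα
      refine ⟨F.sup (Function.surjInv hf) + 1, fun q hq => Finset.mem_filter.mpr ⟨?_, hFα q hq⟩⟩
      refine Finset.mem_image.mpr ⟨Function.surjInv hf q, ?_, Function.surjInv_eq hf q⟩
      exact Finset.mem_range.mpr (Nat.lt_succ_of_le (Finset.le_sup (f := Function.surjInv hf) hq))
    refine hM.2 (fun n => v (G n)) (fun n => hF _) (N α) ?_
    rw [tendsto_nhds_iff]
    intro w
    by_cases hw : w ∈ N α
    · exact Eventually.of_forall fun n => ⟨fun _ => hw, fun _ => hw _ (hGα n)⟩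
    · obtain ⟨F, hFα, hwF⟩ : ∃ F : Finset ℚ, (∀ q ∈ F, (q : ℝ) < α) ∧ w + v F ∉ M := by
        by_contra! h
        exact hw h
      obtain ⟨n₀, hn₀⟩ := hG_exh F hFα
      filter_upwards [eventually_ge_atTop n₀] with n hn
      refine ⟨fun h => absurd (mem_of_le (mem_minus.mp h) ?_) hwF, fun h => absurd h hw⟩
      exact add_le_add_right (hv_mono (hn₀.trans (hG_mono hn))) w
  have hinj : ∀ α β, α < β → N α ≠ N β := by
    intro α β hαβ heq
    obtain ⟨q, hαq, hqβ⟩ := exists_rat_btwn hαβ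
    -- Membership in `N β` allows `q` to be inserted into `F`, which adds one unit at `e q`. Since
    -- `N α = N β`, this can be iterated, against boundedness.
    have hmem : ∀ n : ℕ, (n • Finsupp.single (e q) 1 : FIN) ∈ N α := by
      intro n
      induction n with
      | zero =>
        intro F _
        simpa using hF F
      | succ n ih =>
        rw [heq] at ih
        intro F hFα
        have hq : q ∉ F := fun h => lt_asymm hαq (hFα q h)
        have := ih (insert q F) (by
          intro p hp
          rcases Finset.mem_insert.mp hp with rfl | hp
          · exact hqβ
          · exact (hFα p hp).trans hαβ)
        simp only [v, Finset.sum_insert hq] at this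
        rwa [succ_nsmul, add_assoc]
    obtain ⟨μ, hμ⟩ := hM.1
    have h1 := hmem (μ (e q) + 1) ∅ (by simp)
    have h2 := hμ _ h1 (e q)
    simp [v] at h2
  choose s hs using hN
  have hs_inj : Function.Injective s := by
    intro α β h
    by_contra hne
    have heq : N α = N β := by rw [hs, hs, h]
    rcases lt_or_gt_of_ne hne with h' | h'
    · exact hinj _ _ h' heq
    · exact hinj _ _ h' heq.symm
  -- `FIN` is countable.
  exact not_countable (α := ℝ) hs_inj.countable

end Label

/-! ### Expansions as finite sets of digits -/

/-- The finite sets underlying the expansions. -/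
def IsDigitSet (E : Finset ℤ) : Prop := 0 ∉ E ∧ Set.InjOn Int.natAbs (E : Set ℤ)

/-- The integer with the given set of digits. -/
def digitTime (k : ℤ → ℤ) (E : Finset ℤ) : ℤ := ∑ a ∈ E, k a

/-- The length vector of a set of digits. -/
noncomputable def digitLength (ell : ℕ+ → ℕ+) (E : Finset ℤ) : FIN :=
  ∑ a ∈ E, Finsupp.single (ell a.natAbs.toPNat') 1

namespace IsExpansion

variable {j : List ℤ}

theorem nodup (hj : IsExpansion j) : j.Nodup :=
  hj.1.imp fun h heq => by simp [heq] at h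

theorem isDigitSet_toFinset (hj : IsExpansion j) : IsDigitSet j.toFinset := by
  refine ⟨fun h => hj.2 0 (List.mem_toFinset.mp h) rfl, ?_⟩
  intro a ha a' ha' h
  rw [List.coe_toFinset] at ha ha'
  by_contra hne
  have hsymm : Std.Symm fun a a' : ℤ => |a'| ≠ |a| := ⟨fun _ _ h => h.symm⟩
  have h' := (hj.1.imp (fun h => h.ne) : j.Pairwise fun a a' : ℤ => |a'| ≠ |a|).forall ha ha' hne
  rw [Int.abs_eq_natAbs, Int.abs_eq_natAbs, h] at h'
  exact h' rfl

theorem digitTime_toFinset (hj : IsExpansion j) (k : ℤ → ℤ) :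
    digitTime k j.toFinset = time k j := List.sum_toFinset _ hj.nodup

theorem digitLength_toFinset (hj : IsExpansion j) (ell : ℕ+ → ℕ+) :
    digitLength ell j.toFinset = lengthVector ell j := List.sum_toFinset _ hj.nodup

end IsExpansion

namespace IsDigitSet

theorem exists_isExpansion {E : Finset ℤ} (hE : IsDigitSet E) :
    ∃ j : List ℤ, IsExpansion j ∧ j.toFinset = E := by
  classical
  let R : ℤ → ℤ → Prop := fun a a' => |a'| ≤ |a|
  have htot : Std.Total R := ⟨fun a a' => le_total |a'| |a|⟩
  have htrans : IsTrans ℤ R := ⟨fun a b c h h' => le_trans h' h⟩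
  have hperm := List.perm_insertionSort R E.toList
  have hnodup : (E.toList.insertionSort R).Nodup := hperm.nodup_iff.mpr E.nodup_toList
  have hmem : ∀ a, a ∈ E.toList.insertionSort R ↔ a ∈ E := fun a => by
    rw [hperm.mem_iff, Finset.mem_toList]
  refine ⟨E.toList.insertionSort R, ⟨?_, fun a ha h => hE.1 (h ▸ (hmem a).mp ha)⟩, ?_⟩
  · refine ((List.pairwise_insertionSort R E.toList).and hnodup).imp_of_mem ?_
    rintro a a' ha ha' ⟨hle, hne⟩
    refine lt_of_le_of_ne hle fun h => hne ?_
    refine hE.2 ((hmem a).mp ha) ((hmem a').mp ha') ?_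
    rw [Int.abs_eq_natAbs, Int.abs_eq_natAbs] at h
    exact_mod_cast h.symm
  · ext a
    rw [List.mem_toFinset, hmem]

theorem empty : IsDigitSet ∅ := ⟨by simp, by simp⟩

theorem mono {E F : Finset ℤ} (hE : IsDigitSet E) (h : F ⊆ E) : IsDigitSet F :=
  ⟨fun h0 => hE.1 (h h0), hE.2.mono (by exact_mod_cast h)⟩

theorem of_pos {E : Finset ℤ} (hE : ∀ a ∈ E, 0 < a) : IsDigitSet E := by
  refine ⟨fun h => lt_irrefl _ (hE 0 h), fun a ha a' ha' h => ?_⟩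
  have := hE a ha
  have := hE a' ha'
  lia

theorem union {E F : Finset ℤ} (hE : IsDigitSet E) (hF : IsDigitSet F)
    (h : ∀ a ∈ E, ∀ a' ∈ F, a.natAbs < a'.natAbs) : IsDigitSet (E ∪ F) := by
  constructor
  · rw [Finset.mem_union]
    exact fun h0 => h0.elim hE.1 hF.1
  · intro a ha a' ha' heq
    rw [Finset.mem_coe, Finset.mem_union] at ha ha'
    rcases ha with ha | ha <;> rcases ha' with ha' | ha'
    · exact hE.2 ha ha' heq
    · exact absurd heq (h a ha a' ha').ne
    · exact absurd heq (h a' ha' a ha).ne'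
    · exact hF.2 ha ha' heq

end IsDigitSet

theorem digitTime_union {E F : Finset ℤ} (h : Disjoint E F) (k : ℤ → ℤ) :
    digitTime k (E ∪ F) = digitTime k E + digitTime k F := Finset.sum_union h

theorem digitLength_union {E F : Finset ℤ} (h : Disjoint E F) (ell : ℕ+ → ℕ+) :
    digitLength ell (E ∪ F) = digitLength ell E + digitLength ell F := Finset.sum_union h

theorem digitLength_mono {E F : Finset ℤ} (h : E ⊆ F) (ell : ℕ+ → ℕ+) :
    digitLength ell E ≤ digitLength ell F := Finset.sum_le_sum_of_subset h

/-! ### Expanding functions -/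

namespace IsExpandingFunction

variable {b : ℕ} {k : ℤ → ℤ}

theorem map_zero (hk : IsExpandingFunction b k) : k 0 = 0 := by
  have := hk.1 0
  rw [neg_zero] at this
  lia

theorem pos (hk : IsExpandingFunction b k) (hk1 : 0 < k 1) (n : ℕ) : 0 < k (n + 1 : ℕ) := by
  induction n using Nat.strong_induction_on with
  | _ n ih =>
    rcases n with _ | n
    · exact hk1
    · refine lt_of_le_of_lt ?_ (hk.2 (n + 1))
      refine mul_nonneg (by positivity) (Finset.sum_nonneg fun i hi => ?_)
      rcases i with _ | i
      · exact hk.map_zero.ge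
      · exact (ih i (by simpa using hi)).le

theorem nonneg (hk : IsExpandingFunction b k) (hk1 : 0 < k 1) (n : ℕ) : 0 ≤ k (n : ℤ) := by
  rcases n with _ | n
  · exact hk.map_zero.ge
  · exact (hk.pos hk1 n).le

/-- The only form in which growth enters the comparison of expansions. Differences of two expansions
have coefficients at most 2, so the lower terms amount to at most two thirds of the leading `k n`.
-/
theorem three_mul_sum_le (hk : IsExpandingFunction b k) (hb : 3 ≤ b) (hk1 : 0 < k 1) (n : ℕ) :
    3 * ∑ i ∈ Finset.range n, k (i : ℤ) ≤ k n := by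
  rcases n with _ | n
  · simp [hk.map_zero]
  · have h1 := hk.2 n
    have h2 : 0 ≤ ∑ i ∈ Finset.range (n + 1), k (i : ℤ) :=
      Finset.sum_nonneg fun i _ => hk.nonneg hk1 i
    have h3 : (3 : ℤ) ≤ b := by exact_mod_cast hb
    push_cast
    nlinarith

theorem map_lt_map_succ (hk : IsExpandingFunction b k) (hb : 3 ≤ b) (hk1 : 0 < k 1) (n : ℕ) :
    k (n : ℤ) < k (n + 1 : ℕ) := by
  have h1 := hk.three_mul_sum_le hb hk1 (n + 1)
  have h2 : k (n : ℤ) ≤ ∑ i ∈ Finset.range (n + 1), k (i : ℤ) :=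
    Finset.single_le_sum (f := fun i : ℕ => k (i : ℤ)) (fun i _ => hk.nonneg hk1 i) (by simp)
  have h3 := hk.pos hk1 n
  have h4 := hk.nonneg hk1 n
  lia

theorem strictMono_nat (hk : IsExpandingFunction b k) (hb : 3 ≤ b) (hk1 : 0 < k 1) :
    StrictMono fun n : ℕ => k (n : ℤ) := strictMono_nat_of_lt_succ (hk.map_lt_map_succ hb hk1)

theorem le_map (hk : IsExpandingFunction b k) (hb : 3 ≤ b) (hk1 : 0 < k 1) (n : ℕ) :
    (n : ℤ) ≤ k n := by
  induction n with
  | zero => exact hk.map_zero.ge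
  | succ n ih =>
    have := hk.map_lt_map_succ hb hk1 n
    push_cast at *
    lia

/-- A combination of values of `k` with small coefficients is comparable to its leading term. -/
theorem lt_three_mul_abs_sum (hk : IsExpandingFunction b k) (hb : 3 ≤ b) (hk1 : 0 < k 1)
    {d : ℕ → ℤ} (hd : ∀ i, |d i| ≤ 2) {n : ℕ} (hdn : d n ≠ 0) :
    k n ≤ 3 * |∑ i ∈ Finset.range (n + 1), d i * k i| := by
  rw [Finset.sum_range_succ]
  have h1 : |∑ i ∈ Finset.range n, d i * k i| ≤ 2 * ∑ i ∈ Finset.range n, k (i : ℤ) := by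
    rw [Finset.mul_sum]
    refine (Finset.abs_sum_le_sum_abs _ _).trans (Finset.sum_le_sum fun i _ => ?_)
    rw [abs_mul, abs_of_nonneg (hk.nonneg hk1 i)]
    exact mul_le_mul_of_nonneg_right (hd i) (hk.nonneg hk1 i)
  have h2 : k n ≤ |d n * k n| := by
    rw [abs_mul, abs_of_nonneg (hk.nonneg hk1 n)]
    exact le_mul_of_one_le_left (hk.nonneg hk1 n) (Int.one_le_abs hdn)
  have h3 := hk.three_mul_sum_le hb hk1 n
  have h4 : |d n * k n| - |∑ i ∈ Finset.range n, d i * k i| ≤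
      |∑ i ∈ Finset.range n, d i * k i + d n * k n| := by
    have := abs_sub_abs_le_abs_sub (d n * k n) (-∑ i ∈ Finset.range n, d i * k i)
    rwa [abs_neg, sub_neg_eq_add, add_comm (d n * k n)] at this
  lia

end IsExpandingFunction

/-- The coefficient of `k i` in the integer with the given set of digits. -/
def digitCoeff (E : Finset ℤ) (i : ℕ) : ℤ :=
  (if (i : ℤ) ∈ E then 1 else 0) - (if -(i : ℤ) ∈ E then 1 else 0)

theorem abs_digitCoeff_le (E : Finset ℤ) (i : ℕ) : |digitCoeff E i| ≤ 1 := by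
  unfold digitCoeff
  split_ifs <;> simp

theorem digitTime_eq_sum {k : ℤ → ℤ} (hk : ∀ n, k (-n) = -k n) {E : Finset ℤ} {L : ℕ}
    (hL : ∀ a ∈ E, a.natAbs < L) :
    digitTime k E = ∑ i ∈ Finset.range L, digitCoeff E i * k i := by
  have hk0 : k 0 = 0 := by
    have := hk 0
    rw [neg_zero] at this
    lia
  have h1 : ∀ a ∈ E, k a = ∑ i ∈ Finset.range L,
      ((if a = (i : ℤ) then 1 else 0) - (if a = -(i : ℤ) then 1 else 0)) * k i := by
    intro a ha
    rw [Finset.sum_eq_single_of_mem a.natAbs (Finset.mem_range.mpr (hL a ha))]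
    · rcases lt_trichotomy a 0 with h | rfl | h
      · have h2 : ((a.natAbs : ℕ) : ℤ) = -a := by lia
        rw [h2, hk, if_neg (by lia), if_pos (by lia)]
        ring
      · simp [hk0]
      · have h2 : ((a.natAbs : ℕ) : ℤ) = a := by lia
        rw [h2, if_pos rfl, if_neg (by lia)]
        ring
    · intro i _ hi
      rw [if_neg (by lia), if_neg (by lia)]
      ring
  rw [digitTime, Finset.sum_congr rfl h1, Finset.sum_comm]
  refine Finset.sum_congr rfl fun i _ => ?_
  rw [← Finset.sum_mul, Finset.sum_sub_distrib]
  simp [digitCoeff]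

/-- A digit set never contains both `i` and `-i`, so no cancellation hides a digit. -/
theorem IsDigitSet.mem_iff_digitCoeff {E : Finset ℤ} (hE : IsDigitSet E) {i : ℕ} (hi : i ≠ 0) :
    ((i : ℤ) ∈ E ↔ digitCoeff E i = 1) ∧ (-(i : ℤ) ∈ E ↔ digitCoeff E i = -1) := by
  have h : ¬((i : ℤ) ∈ E ∧ -(i : ℤ) ∈ E) := by
    rintro ⟨h1, h2⟩
    have := hE.2 h1 h2 (by simp)
    lia
  unfold digitCoeff
  split_ifs <;> simp_all

/-- The leading digits of an expansion are determined by the approximate value of the time. -/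
theorem filter_eq_of_digitTime_near {b : ℕ} {k : ℤ → ℤ} (hk : IsExpandingFunction b k)
    (hb : 3 ≤ b) (hk1 : 0 < k 1) {E T : Finset ℤ} (hE : IsDigitSet E) (hT : IsDigitSet T)
    {m : ℕ} (hm : 0 < m) (hTm : ∀ a ∈ T, m ≤ a.natAbs)
    (hs : 3 * |digitTime k E - digitTime k T| < k m) :
    E.filter (fun a => m ≤ a.natAbs) = T := by
  let d : ℕ → ℤ := fun i => digitCoeff E i - digitCoeff T i
  have hd2 : ∀ i, |d i| ≤ 2 := fun i =>
    (abs_sub _ _).trans (add_le_add (abs_digitCoeff_le E i) (abs_digitCoeff_le T i))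
  let L := (E ∪ T).sup Int.natAbs + 1
  have hL : ∀ a ∈ E ∪ T, a.natAbs < L := fun a ha =>
    Nat.lt_succ_of_le (Finset.le_sup (f := Int.natAbs) ha)
  have hsum : digitTime k E - digitTime k T = ∑ i ∈ Finset.range L, d i * k i := by
    rw [digitTime_eq_sum hk.1 fun a ha => hL a (Finset.mem_union_left _ ha),
      digitTime_eq_sum hk.1 fun a ha => hL a (Finset.mem_union_right _ ha),
      ← Finset.sum_sub_distrib]
    exact Finset.sum_congr rfl fun i _ => (sub_mul _ _ _).symm
  have hd0 : ∀ i, L ≤ i → d i = 0 := by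
    intro i hi
    have h : ∀ a : ℤ, a.natAbs = i → a ∉ E ∧ a ∉ T := fun a ha =>
      ⟨fun h => (hL a (Finset.mem_union_left _ h)).not_ge (ha ▸ hi),
        fun h => (hL a (Finset.mem_union_right _ h)).not_ge (ha ▸ hi)⟩
    have h1 := h i (by simp)
    have h2 := h (-i) (by simp)
    simp [d, digitCoeff, h1, h2]
  have hdm : ∀ i, m ≤ i → d i = 0 := by
    -- At the largest `n` with `d n ≠ 0`, which is at least `m`, the leading term would force `k m ≤
    -- k n ≤ 3 * |difference|`, contrary to `hs`.
    by_contra! h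
    let s := (Finset.range L).filter fun i => d i ≠ 0
    have hmem : ∀ i, i ∈ s ↔ d i ≠ 0 := by
      intro i
      rw [Finset.mem_filter, Finset.mem_range]
      exact ⟨fun h => h.2, fun h => ⟨not_le.mp fun h' => h (hd0 i h'), h⟩⟩
    obtain ⟨i₀, hi₀m, hi₀⟩ := h
    have hne : s.Nonempty := ⟨i₀, (hmem i₀).mpr hi₀⟩
    let n := s.max' hne
    have hn : d n ≠ 0 := (hmem n).mp (s.max'_mem hne)
    have hmn : m ≤ n := hi₀m.trans (s.le_max' i₀ ((hmem i₀).mpr hi₀))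
    have hnL : n + 1 ≤ L := Nat.succ_le_of_lt (not_le.mp fun h' => hn (hd0 n h'))
    have hrange : ∑ i ∈ Finset.range (n + 1), d i * k i = ∑ i ∈ Finset.range L, d i * k i := by
      refine Finset.sum_subset (Finset.range_mono hnL) fun i _ hi => ?_
      have : d i = 0 := by
        by_contra h'
        exact hi (Finset.mem_range.mpr (Nat.lt_succ_of_le (s.le_max' i ((hmem i).mpr h'))))
      rw [this, zero_mul]
    have h1 := hk.lt_three_mul_abs_sum hb hk1 hd2 hn
    rw [hrange, ← hsum] at h1
    have h2 := (hk.strictMono_nat hb hk1).monotone hmn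
    exact absurd hs (not_lt.mpr (h2.trans h1))
  have hiff : ∀ a : ℤ, m ≤ a.natAbs → (a ∈ E ↔ a ∈ T) := by
    intro a ha
    have h1 : digitCoeff E a.natAbs = digitCoeff T a.natAbs := sub_eq_zero.mp (hdm _ ha)
    have h2 : a.natAbs ≠ 0 := (hm.trans_le ha).ne'
    have hE' := hE.mem_iff_digitCoeff h2
    have hT' := hT.mem_iff_digitCoeff h2
    rcases Int.natAbs_eq a with h | h <;> rw [h]
    · rw [hE'.1, hT'.1, h1]
    · rw [hE'.2, hT'.2, h1]
  ext a
  rw [Finset.mem_filter]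
  exact ⟨fun h => (hiff a h.2).mp h.1, fun h => ⟨(hiff a (hTm a h)).mpr h, hTm a h⟩⟩

/-- The case of distance 0 and threshold `m = 1` of the comparison of leading digits, since all
digits are nonzero. -/
theorem digitTime_injOn {b : ℕ} {k : ℤ → ℤ} (hk : IsExpandingFunction b k)
    (hb : 3 ≤ b) (hk1 : 0 < k 1) : Set.InjOn (digitTime k) {E | IsDigitSet E} := by
  intro E hE T hT h
  have hpos : ∀ {F : Finset ℤ}, IsDigitSet F → ∀ a ∈ F, 1 ≤ a.natAbs := fun hF a ha => by
    have : a ≠ 0 := fun h0 => hF.1 (h0 ▸ ha)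
    lia
  have h1 := filter_eq_of_digitTime_near hk hb hk1 hE hT one_pos (hpos hT)
    (by rw [h, sub_self]; simpa using hk1)
  rwa [Finset.filter_true_of_mem (hpos hE)] at h1

/-! ### Sets of digits of labels -/

/-- The subsets of a set whose finite subsets have length vectors in a simple label are finite. -/
theorem finite_of_digitLength_mem {M : Label} (hM : M.IsSimple) (ell : ℕ+ → ℕ+) {C : Set ℤ}
    (hC : ∀ F : Finset ℤ, (F : Set ℤ) ⊆ C → digitLength ell F ∈ M) : C.Finite := by
  by_contra hinf
  obtain ⟨μ, hμ⟩ := hM.1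
  let g : ℤ → ℕ+ := fun a => ell a.natAbs.toPNat'
  -- Boundedness allows at most `μ l` elements of `C` over `l`, so an infinite `C` must meet
  -- infinitely many classes.
  have hfib : ∀ l, (C ∩ g ⁻¹' {l}).Finite := by
    intro l
    by_contra h
    obtain ⟨F, hF, hcard⟩ := Set.Infinite.exists_subset_card_eq h (μ l + 1)
    have h1 := hμ _ (hC F (hF.trans Set.inter_subset_left)) l
    have h2 : digitLength ell F = ∑ a ∈ F, Finsupp.single l 1 :=
      Finset.sum_congr rfl fun a ha => by
        have h3 : g a = l := (hF ha).2
        rw [← h3]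
    rw [h2, Finset.sum_const, hcard] at h1
    simp at h1
  have himg : (g '' C).Infinite := by
    intro h
    refine hinf ((h.biUnion fun l _ => hfib l).subset fun a ha => ?_)
    exact Set.mem_biUnion (Set.mem_image_of_mem g ha) ⟨ha, rfl⟩
  have := himg.to_subtype
  let e₀ : ℚ → g '' C := Infinite.natEmbedding _ ∘ Denumerable.eqv ℚ
  have he₀ : Function.Injective e₀ :=
    (Infinite.natEmbedding _).injective.comp (Denumerable.eqv ℚ).injective
  choose c hcC hcg using fun q : ℚ => (e₀ q).2
  have hc : Function.Injective c := by
    intro q q' h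
    refine he₀ (Subtype.ext ?_)
    rw [← hcg, ← hcg, h]
  obtain ⟨F, hF⟩ := hM.exists_sum_single_notMem (e := fun q => g (c q))
  refine hF ?_
  have h1 := hC (F.map ⟨c, hc⟩) (by
    intro a ha
    obtain ⟨q, -, rfl⟩ := Finset.mem_map.mp ha
    exact hcC q)
  rwa [digitLength, Finset.sum_map] at h1

/-- Every vector is the length vector of positive expansions with arbitrarily large digits. -/
theorem exists_digitLength_eq {ell : ℕ+ → ℕ+} (hell : ∀ l, {n | ell n = l}.Infinite) (r : FIN)
    (m : ℕ) : ∃ T : Finset ℤ, IsDigitSet T ∧ (∀ a ∈ T, 0 < a) ∧ (∀ a ∈ T, m ≤ a.natAbs) ∧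
      digitLength ell T = r := by
  suffices h : ∃ T : Finset ℤ, (∀ a ∈ T, 0 < a) ∧ (∀ a ∈ T, m ≤ a.natAbs) ∧
      digitLength ell T = r by
    obtain ⟨T, h1, h2, h3⟩ := h
    exact ⟨T, IsDigitSet.of_pos h1, h1, h2, h3⟩
  have hadd : ∀ r s : FIN,
      (∀ m : ℕ, ∃ T : Finset ℤ, (∀ a ∈ T, 0 < a) ∧ (∀ a ∈ T, m ≤ a.natAbs) ∧
        digitLength ell T = r) →
      (∀ m : ℕ, ∃ T : Finset ℤ, (∀ a ∈ T, 0 < a) ∧ (∀ a ∈ T, m ≤ a.natAbs) ∧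
        digitLength ell T = s) →
      ∀ m : ℕ, ∃ T : Finset ℤ, (∀ a ∈ T, 0 < a) ∧ (∀ a ∈ T, m ≤ a.natAbs) ∧
        digitLength ell T = r + s := by
    intro r s hr hs m
    obtain ⟨T, hT0, hTm, rfl⟩ := hr m
    -- The second set is placed beyond all digits of the first, so that the union repeats no digit
    -- and lengths add.
    obtain ⟨T', hT'0, hT'm, rfl⟩ := hs (m + T.sup Int.natAbs + 1)
    have hdisj : Disjoint T T' := by
      refine Finset.disjoint_left.mpr fun a ha ha' => ?_
      have h1 := Finset.le_sup (f := Int.natAbs) ha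
      have h2 := hT'm a ha'
      lia
    refine ⟨T ∪ T', fun a ha => ?_, fun a ha => ?_, digitLength_union hdisj ell⟩
    · exact (Finset.mem_union.mp ha).elim (hT0 a) (hT'0 a)
    · rcases Finset.mem_union.mp ha with ha | ha
      · exact hTm a ha
      · have := hT'm a ha
        lia
  have hzero : ∀ m : ℕ, ∃ T : Finset ℤ, (∀ a ∈ T, 0 < a) ∧ (∀ a ∈ T, m ≤ a.natAbs) ∧
      digitLength ell T = 0 := fun m => ⟨∅, by simp, by simp, rfl⟩
  induction r using Finsupp.induction_linear generalizing m with
  | zero => exact hzero m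
  | add r s hr hs => exact hadd r s hr hs m
  | single l n =>
    induction n generalizing m with
    | zero => simpa using hzero m
    | succ n ih =>
      rw [Finsupp.single_add]
      refine hadd _ _ ih (fun m => ?_) m
      obtain ⟨a, hal, ha⟩ := (hell l).exists_gt m.toPNat'
      have ha' : m < (a : ℕ) := by
        have h : (m.toPNat' : ℕ) < a := ha
        rw [Nat.toPNat'_coe] at h
        split_ifs at h <;> lia
      refine ⟨{((a : ℕ) : ℤ)}, by simp, by simpa using ha'.le, ?_⟩
      have hal' : ell a = l := hal
      simp [digitLength, hal']

/-! ### Enveloping semigroups -/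

namespace Enveloping

section

variable {Γ X : Type*} [AddMonoid Γ] [AddAction Γ X] [TopologicalSpace X]

@[ext] theorem ext' {p q : Enveloping Γ X} (h : ∀ x, p x = q x) : p = q := Subtype.ext (funext h)

theorem continuous_eval (x : X) : Continuous fun p : Enveloping Γ X => p x :=
  (continuous_apply x).comp continuous_subtype_val

theorem tendsto_iff {ι : Type*} {l : Filter ι} {u : ι → Enveloping Γ X} {p : Enveloping Γ X} :
    Tendsto u l (𝓝 p) ↔ ∀ x, Tendsto (fun i => u i x) l (𝓝 (p x)) :=
  tendsto_subtype_rng.trans tendsto_pi_nhds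

theorem continuous_iff {Y : Type*} [TopologicalSpace Y] {f : Y → Enveloping Γ X} :
    Continuous f ↔ ∀ x, Continuous fun y => f y x :=
  Topology.IsInducing.subtypeVal.continuous_iff.trans continuous_pi_iff

end

section

variable {Γ X : Type*} [AddCommMonoid Γ] [AddAction Γ X] [TopologicalSpace X]

/-- Commuting with `γ` is a pointwise closed condition, and it holds for translations because `Γ` is
commutative. -/
theorem map_vadd [ContinuousConstVAdd Γ X] [T2Space X] (p : Enveloping Γ X) (γ : Γ) (x : X) :
    p (γ +ᵥ x) = γ +ᵥ p x := by
  have hclosed : IsClosed {f : X → X | f (γ +ᵥ x) = γ +ᵥ f x} :=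
    isClosed_eq (continuous_apply _) ((continuous_const_vadd γ).comp (continuous_apply _))
  refine (closure_minimal ?_ hclosed) p.2
  rintro _ ⟨δ, rfl⟩
  change δ +ᵥ (γ +ᵥ x) = γ +ᵥ (δ +ᵥ x)
  rw [vadd_vadd, vadd_vadd, add_comm]

/-- A continuous element commutes with all elements. -/
theorem map_apply_of_continuous [ContinuousConstVAdd Γ X] [T2Space X] {g : Enveloping Γ X}
    (hg : Continuous (g : X → X)) (p : Enveloping Γ X) (x : X) : p (g x) = g (p x) := by
  -- Continuity of `g` is what makes this condition closed in `f`.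
  have hclosed : IsClosed {f : X → X | f (g x) = g (f x)} :=
    isClosed_eq (continuous_apply _) (hg.comp (continuous_apply _))
  refine (closure_minimal ?_ hclosed) p.2
  rintro _ ⟨δ, rfl⟩
  exact (map_vadd g δ x).symm

/-- If the continuous elements act transitively from a point, then all elements are determined by
their value at this point. -/
theorem eq_of_apply_eq [ContinuousConstVAdd Γ X] [T2Space X] {x : X}
    (hx : ∀ y, ∃ g : Enveloping Γ X, Continuous (g : X → X) ∧ g x = y)
    {p q : Enveloping Γ X} (h : p x = q x) : p = q := by
  refine ext' fun y => ?_
  obtain ⟨g, hg, rfl⟩ := hx y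
  rw [map_apply_of_continuous hg, map_apply_of_continuous hg, h]

/-- Some continuous `g` agrees with `p` at `x`, hence equals `p`. -/
theorem continuous_of_transitive [ContinuousConstVAdd Γ X] [T2Space X] {x : X}
    (hx : ∀ y, ∃ g : Enveloping Γ X, Continuous (g : X → X) ∧ g x = y)
    (p : Enveloping Γ X) : Continuous (p : X → X) := by
  obtain ⟨g, hg, h⟩ := hx (p x)
  rwa [← eq_of_apply_eq hx h]

theorem mul_comm_of_transitive [ContinuousConstVAdd Γ X] [T2Space X] {x : X}
    (hx : ∀ y, ∃ g : Enveloping Γ X, Continuous (g : X → X) ∧ g x = y)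
    (p q : Enveloping Γ X) : p * q = q * p :=
  ext' fun y => map_apply_of_continuous (continuous_of_transitive hx q) p y

end

end Enveloping

/-! ### The enveloping semigroup of a simple label -/

namespace Label

theorem IsSimple.exists_of_apply_eq {M : Label} (hM : M.IsSimple) (N : M.Theta) :
    ∃ g : Enveloping FIN M.Theta, Continuous (g : M.Theta → M.Theta) ∧
      g ⟨M, self_mem_orbitClosure FIN M⟩ = N := by
  obtain ⟨s, hs⟩ := hM.exists_eq_minus N.2
  exact ⟨Enveloping.of s, continuous_const_vadd s, Subtype.ext hs.symm⟩

/-- The value at `M` is some `M - r`, and it determines `Q`; so taking the closure of the maps `P_r`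
adds nothing. -/
theorem IsSimple.exists_eq_of {M : Label} (hM : M.IsSimple) (Q : Enveloping FIN M.Theta) :
    ∃ r : FIN, Q = Enveloping.of r := by
  obtain ⟨r, hr⟩ := hM.exists_eq_minus (Q ⟨M, self_mem_orbitClosure FIN M⟩).2
  exact ⟨r, Enveloping.eq_of_apply_eq hM.exists_of_apply_eq (Subtype.ext hr)⟩

end Label

/-! ### Codings of labels by points of the full shift -/

/-- The map `pt` sends a label `N` to the characteristic function of the set of times with
expansions whose digits satisfy `P` and whose length vectors are in `N`. -/
structure IsLabelCoding (b : ℕ) (k : ℤ → ℤ) (ell : ℕ+ → ℕ+) (P : ℤ → Prop)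
    (pt : Label → ℤ → Bool) : Prop where
  three_le : 3 ≤ b
  expanding : IsExpandingFunction b k
  map_one_pos : 0 < k 1
  infinite : ∀ l, {n | ell n = l}.Infinite
  of_pos : ∀ a, 0 < a → P a
  apply_iff : ∀ N t, pt N t = true ↔
    ∃ E, IsDigitSet E ∧ (∀ a ∈ E, P a) ∧ t = digitTime k E ∧ digitLength ell E ∈ N

theorem tendsto_bool_iff {ι : Type*} {l : Filter ι} {u : ι → ℤ → Bool} {x : ℤ → Bool} :
    Tendsto u l (𝓝 x) ↔ ∀ t, ∀ᶠ i in l, u i t = x t := by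
  rw [tendsto_pi_nhds]
  refine forall_congr' fun t => ?_
  rw [nhds_discrete, tendsto_pure]

namespace IsLabelCoding

variable {b : ℕ} {k : ℤ → ℤ} {ell : ℕ+ → ℕ+} {P : ℤ → Prop} {pt : Label → ℤ → Bool}

/-! ### Reading the label from the coded point -/

theorem apply_digitTime (h : IsLabelCoding b k ell P pt) {N : Label} {E : Finset ℤ}
    (hE : IsDigitSet E) (hEP : ∀ a ∈ E, P a) :
    pt N (digitTime k E) = true ↔ digitLength ell E ∈ N := by
  rw [h.apply_iff]
  constructor
  · rintro ⟨F, hF, -, hEF, hFN⟩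
    rwa [digitTime_injOn h.expanding h.three_le h.map_one_pos hE hF hEF]
  · exact fun hN => ⟨E, hE, hEP, rfl, hN⟩

theorem apply_of_minus (h : IsLabelCoding b k ell P pt) {N : Label} {r : FIN} {t : ℤ}
    (ht : pt (N.minus r) t = true) : pt N t = true := by
  obtain ⟨E, hE, hEP, rfl, hN⟩ := (h.apply_iff _ _).mp ht
  exact (h.apply_digitTime hE hEP).mpr (Label.minus_subset hN)

theorem apply_eq_false (h : IsLabelCoding b k ell P pt) {N : Label} {r : FIN} (hr : r ∉ N)
    (t : ℤ) : pt (N.minus r) t = false := by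
  rw [← Bool.not_eq_true, h.apply_iff]
  rintro ⟨E, -, -, -, hN⟩
  exact hr (Label.mem_of_le (Label.mem_minus.mp hN) le_add_self)

/-- Translation by a time with large digits amounts locally to the subtraction of its length
vector. -/
theorem apply_add (h : IsLabelCoding b k ell P pt) (N : Label) {T : Finset ℤ}
    (hT : IsDigitSet T) (hTP : ∀ a ∈ T, P a) {m : ℕ} (hm : 0 < m)
    (hTm : ∀ a ∈ T, m ≤ a.natAbs) {s : ℤ} (hs : 3 * |s| < k m) :
    pt N (s + digitTime k T) = pt (N.minus (digitLength ell T)) s := by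
  rw [Bool.eq_iff_iff, h.apply_iff, h.apply_iff]
  constructor
  · rintro ⟨E, hE, hEP, hsE, hEN⟩
    have hsE' : digitTime k E - digitTime k T = s := by rw [← hsE]; ring
    have hfilter := filter_eq_of_digitTime_near h.expanding h.three_le h.map_one_pos hE hT hm hTm
      (by rwa [hsE'])
    have hTE : T ⊆ E := hfilter ▸ Finset.filter_subset _ _
    have hdisj : Disjoint (E \ T) T := Finset.sdiff_disjoint
    have hunion : (E \ T) ∪ T = E := Finset.sdiff_union_of_subset hTE
    refine ⟨E \ T, hE.mono Finset.sdiff_subset, fun a ha => hEP a (Finset.sdiff_subset ha), ?_, ?_⟩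
    · rw [← hsE', ← hunion, digitTime_union hdisj, hunion]
      ring
    · rw [Label.mem_minus, ← digitLength_union hdisj, hunion]
      exact hEN
  · rintro ⟨F, hF, hFP, rfl, hFN⟩
    -- Comparison with the empty digit set: a time as small as `s` has no digit of size `m` or more,
    -- so the digits of `T` can be adjoined.
    have hfilter := filter_eq_of_digitTime_near h.expanding h.three_le h.map_one_pos hF
      IsDigitSet.empty hm (by simp) (by simpa [digitTime] using hs)
    have hFm : ∀ a ∈ F, a.natAbs < m := fun a ha =>
      not_le.mp (Finset.filter_eq_empty_iff.mp hfilter ha)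
    have hFT : ∀ a ∈ F, ∀ a' ∈ T, a.natAbs < a'.natAbs := fun a ha a' ha' =>
      (hFm a ha).trans_le (hTm a' ha')
    have hdisj : Disjoint F T := Finset.disjoint_left.mpr fun a ha ha' => (hFT a ha a ha').false
    refine ⟨F ∪ T, hF.union hT hFT, fun a ha => ?_, (digitTime_union hdisj k).symm, ?_⟩
    · exact (Finset.mem_union.mp ha).elim (hFP a) (hTP a)
    · rw [digitLength_union hdisj]
      exact hFN

/-- Each coordinate depends on the label through the membership of at most one vector, the length
vector of the unique expansion of `t`. -/
theorem continuous (h : IsLabelCoding b k ell P pt) : Continuous pt := by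
  refine continuous_iff_continuousAt.mpr fun N => tendsto_bool_iff.mpr fun t => ?_
  by_cases ht : ∃ E, IsDigitSet E ∧ (∀ a ∈ E, P a) ∧ t = digitTime k E
  · obtain ⟨E, hE, hEP, rfl⟩ := ht
    have hid : Tendsto (fun N : Label => N) (𝓝 N) (𝓝 N) := tendsto_id
    filter_upwards [Label.tendsto_nhds_iff.mp hid (digitLength ell E)] with N' hN'
    rw [Bool.eq_iff_iff, h.apply_digitTime hE hEP, h.apply_digitTime hE hEP, hN']
  · have hfalse : ∀ N, pt N t = false := fun N => by
      rw [← Bool.not_eq_true, h.apply_iff]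
      exact fun ⟨E, hE, hEP, htE, _⟩ => ht ⟨E, hE, hEP, htE⟩
    exact Eventually.of_forall fun N' => (hfalse N').trans (hfalse N).symm

/-- Every vector is the length vector of a positive expansion, so its membership is visible at some
time. -/
theorem injective (h : IsLabelCoding b k ell P pt) : Function.Injective pt := by
  intro N N' heq
  ext r
  obtain ⟨T, hT, hT0, -, rfl⟩ := exists_digitLength_eq h.infinite r 0
  have hTP : ∀ a ∈ T, P a := fun a ha => h.of_pos a (hT0 a ha)
  have h1 := h.apply_digitTime (N := N) hT hTP
  have h2 := h.apply_digitTime (N := N') hT hTP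
  rw [heq] at h1
  exact h1.symm.trans h2

/-! ### Limits of translates of coded points -/

theorem tendsto_digitTime_vadd (h : IsLabelCoding b k ell P pt) {ι : Type*} {l : Filter ι}
    {T : ι → Finset ℤ} (hT : ∀ᶠ i in l, IsDigitSet (T i)) (hTP : ∀ᶠ i in l, ∀ a ∈ T i, P a)
    (hTm : ∀ m : ℕ, ∀ᶠ i in l, ∀ a ∈ T i, m ≤ a.natAbs) {N : ι → Label} {N' : Label}
    (hN : Tendsto (fun i => (N i).minus (digitLength ell (T i))) l (𝓝 N')) :
    Tendsto (fun i => digitTime k (T i) +ᵥ pt (N i)) l (𝓝 (pt N')) := by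
  rw [tendsto_bool_iff]
  intro t
  -- This threshold suffices because `m ≤ k m`.
  let m : ℕ := 3 * t.natAbs + 1
  have hm : 3 * |t| < k m := by
    have := h.expanding.le_map h.three_le h.map_one_pos m
    rw [Int.abs_eq_natAbs]
    lia
  filter_upwards [hT, hTP, hTm m,
    tendsto_bool_iff.mp ((h.continuous.tendsto N').comp hN) t] with i hi hiP him hiN
  exact (h.apply_add (N i) hi hiP (by lia) him hm).trans hiN

/-- The main compactness statement. The point is that `n'` and `s'` do not depend on `r`: `r = 0`
describes the limit points, and comparison with general `r` gives continuity of `p_r`. -/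
theorem exists_tendsto_vadd (h : IsLabelCoding b k ell P pt) {M : Label} (hM : M.IsSimple)
    {ι : Type*} (U : Ultrafilter ι) (n : ι → ℤ) (s : ι → FIN) :
    ∃ (n' : ℤ) (s' : FIN), ∀ r : FIN,
      Tendsto (fun i => n i +ᵥ pt ((M.minus (s i)).minus r)) U
        (𝓝 (n' +ᵥ pt ((M.minus s').minus r))) := by
  classical
  -- If every coordinate vanishes in the limit, the limit is the zero sequence, coded by the empty
  -- label. Otherwise one coordinate `t` stays 1, and the times `t + n i` have expansions.
  by_cases hzero : ∀ t, ∀ᶠ i in U, ¬ pt (M.minus (s i)) (t + n i) = true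
  · obtain ⟨s', hs'⟩ := hM.1.exists_notMem
    refine ⟨0, s', fun r => tendsto_bool_iff.mpr fun t => ?_⟩
    filter_upwards [hzero t] with i hi
    have h1 : (n i +ᵥ pt ((M.minus (s i)).minus r)) t = false :=
      Bool.eq_false_iff.mpr fun h' => hi (h.apply_of_minus h')
    have h2 : ((0 : ℤ) +ᵥ pt ((M.minus s').minus r)) t = false := by
      rw [Label.minus_comm]
      exact h.apply_eq_false (fun h' => hs' (Label.minus_subset h')) _
    rw [h1, h2]
  push Not at hzero
  obtain ⟨t, ht⟩ := hzero
  have hchoose : ∀ i, ∃ E, pt (M.minus (s i)) (t + n i) = true →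
      IsDigitSet E ∧ (∀ a ∈ E, P a) ∧ t + n i = digitTime k E ∧
        digitLength ell E ∈ M.minus (s i) := by
    intro i
    by_cases hi : pt (M.minus (s i)) (t + n i) = true
    · obtain ⟨E, hE⟩ := (h.apply_iff _ _).mp hi
      exact ⟨E, fun _ => hE⟩
    · exact ⟨∅, fun h' => absurd h' hi⟩
  choose E hE using hchoose
  replace hE := ht.mono fun i => hE i
  let C : Set ℤ := {a | ∀ᶠ i in U, a ∈ E i}
  have hsub : ∀ F : Finset ℤ, (F : Set ℤ) ⊆ C → ∀ᶠ i in U, F ⊆ E i := fun F hF =>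
    (Filter.eventually_all_finset F).mpr fun a ha => hF ha
  -- A finite set of persistent digits lies in a single `E i`, whose length vector is in `M`.
  have hC : C.Finite := finite_of_digitLength_mem hM ell fun F hF => by
    obtain ⟨i, hiF, hi⟩ := ((hsub F hF).and hE).exists
    exact Label.mem_of_le (Label.minus_subset hi.2.2.2) (digitLength_mono hiF ell)
  obtain ⟨C', hC'⟩ := hC.exists_finset_coe
  have hC'E : ∀ᶠ i in U, C' ⊆ E i := hsub C' hC'.le
  let T : ι → Finset ℤ := fun i => E i \ C'
  -- Each of the finitely many small integers either persists, and was removed with `C'`, or is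
  -- absent from `E i` along the ultrafilter.
  have hTm : ∀ m : ℕ, ∀ᶠ i in U, ∀ a ∈ T i, m ≤ a.natAbs := by
    intro m
    have hall : ∀ a ∈ Finset.Icc (-m : ℤ) m, ∀ᶠ i in U, a ∉ T i := by
      intro a _
      by_cases ha : a ∈ C
      · refine Eventually.of_forall fun i => ?_
        rw [← hC'] at ha
        simp only [T, Finset.mem_sdiff, not_and_not_right]
        exact fun _ => ha
      · exact (Ultrafilter.eventually_not.mpr ha).mono fun i hi h' =>
          hi (Finset.sdiff_subset h')
    filter_upwards [(Filter.eventually_all_finset _).mpr hall] with i hi a ha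
    by_contra hlt
    exact hi a (Finset.mem_Icc.mpr (by lia)) ha
  obtain ⟨N', hN'⟩ := Label.exists_tendsto_ultrafilter U
    fun i => (M.minus (s i)).minus (digitLength ell (T i))
  have hN'M : N' ∈ M.Theta := by
    refine isClosed_closure.mem_of_tendsto hN' (Eventually.of_forall fun i => ?_)
    rw [Label.minus_minus]
    exact M.minus_mem_Theta _
  obtain ⟨s', rfl⟩ := hM.exists_eq_minus hN'M
  -- The persistent digits, corrected by `t`, are the constant part of `n i`; the rest of `n i` is
  -- the time of `T i`.
  refine ⟨digitTime k C' - t, s', fun r => ?_⟩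
  have hlim : Tendsto (fun i => digitTime k (T i) +ᵥ pt ((M.minus (s i)).minus r)) U
      (𝓝 (pt ((M.minus s').minus r))) := by
    refine h.tendsto_digitTime_vadd (hE.mono fun i hi => hi.1.mono Finset.sdiff_subset)
      (hE.mono fun i hi a ha => hi.2.1 a (Finset.sdiff_subset ha)) hTm ?_
    refine (((Label.continuous_minus r).tendsto _).comp hN').congr fun i => ?_
    exact Label.minus_comm _ _ _
  refine (((continuous_const_vadd (digitTime k C' - t)).tendsto _).comp hlim).congr' ?_
  filter_upwards [hE, hC'E] with i hi hiC
  have hn : n i = digitTime k C' - t + digitTime k (T i) := by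
    have h1 : digitTime k (E i) = digitTime k (T i) + digitTime k C' := by
      rw [← digitTime_union Finset.sdiff_disjoint, Finset.sdiff_union_of_subset hiC]
    have h2 := hi.2.2.1
    lia
  rw [hn, add_vadd]
  rfl

theorem exists_eq_vadd (h : IsLabelCoding b k ell P pt) {M : Label} (hM : M.IsSimple)
    {y : ℤ → Bool} (hy : y ∈ orbitClosure ℤ (pt M)) :
    ∃ (n : ℤ) (s : FIN), y = n +ᵥ pt (M.minus s) := by
  obtain ⟨U, hU, hUy⟩ := mem_closure_iff_ultrafilter.mp hy
  -- The ultrafilter lives on the points themselves, so each orbit point needs a chosen shift; the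
  -- value 0 off the orbit is irrelevant.
  have hex : ∀ z : ℤ → Bool, ∃ n : ℤ,
      z ∈ Set.range (fun n : ℤ => n +ᵥ pt M) → n +ᵥ pt M = z := by
    intro z
    by_cases hz : z ∈ Set.range (fun n : ℤ => n +ᵥ pt M)
    · obtain ⟨n, hn⟩ := hz
      exact ⟨n, fun _ => hn⟩
    · exact ⟨0, fun h' => absurd h' hz⟩
  choose n hn using hex
  obtain ⟨n', s', hlim⟩ := h.exists_tendsto_vadd hM U n fun _ => 0
  refine ⟨n', s', tendsto_nhds_unique hUy (((hlim 0).congr' ?_).trans (by rw [Label.minus_zero]))⟩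
  filter_upwards [hU] with z hz
  rw [Label.minus_zero, Label.minus_zero, hn z hz]

/-- A sequence of times with prescribed length vector whose digits tend to infinity. -/
theorem exists_digits_tendsto (h : IsLabelCoding b k ell P pt) (r : FIN) :
    ∃ T : ℕ → Finset ℤ, ∀ N : Label, Tendsto (fun i => digitTime k (T i) +ᵥ pt N) atTop
      (𝓝 (pt (N.minus r))) := by
  choose T hT hT0 hTm hTr using exists_digitLength_eq h.infinite r
  refine ⟨T, fun N => h.tendsto_digitTime_vadd (Eventually.of_forall hT)
    (Eventually.of_forall fun i a ha => h.of_pos a (hT0 i a ha)) (fun m => ?_) ?_⟩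
  · filter_upwards [eventually_ge_atTop m] with i hi a ha
    exact hi.trans (hTm i a ha)
  · simp only [hTr]
    exact tendsto_const_nhds

/-! ### The elements `p_r` and the enveloping semigroup of the subshift -/

theorem mem_orbitClosure (h : IsLabelCoding b k ell P pt) (M : Label) (s : FIN) (n : ℤ) :
    n +ᵥ pt (M.minus s) ∈ orbitClosure ℤ (pt M) := by
  refine vadd_mem_orbitClosure n ?_
  obtain ⟨T, hT⟩ := h.exists_digits_tendsto s
  exact mem_closure_of_tendsto (hT M) (Eventually.of_forall fun i => ⟨_, rfl⟩)

theorem exists_limitElement (h : IsLabelCoding b k ell P pt) {M : Label} (hM : M.IsSimple)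
    (r : FIN) : ∃ p : Enveloping ℤ (orbitClosure ℤ (pt M)),
      Continuous (p : orbitClosure ℤ (pt M) → orbitClosure ℤ (pt M)) ∧
      ∀ (y : orbitClosure ℤ (pt M)) (n : ℤ) (s : FIN), (y : ℤ → Bool) = n +ᵥ pt (M.minus s) →
        (p y : ℤ → Bool) = n +ᵥ pt ((M.minus s).minus r) := by
  choose n s hns using fun y : orbitClosure ℤ (pt M) => h.exists_eq_vadd hM y.2
  obtain ⟨T, hT⟩ := h.exists_digits_tendsto r
  have hlim : ∀ (y : orbitClosure ℤ (pt M)) (n : ℤ) (s : FIN),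
      (y : ℤ → Bool) = n +ᵥ pt (M.minus s) →
      Tendsto (fun i => digitTime k (T i) +ᵥ (y : ℤ → Bool)) atTop
        (𝓝 (n +ᵥ pt ((M.minus s).minus r))) := by
    intro y n s hy
    refine (((continuous_const_vadd n).tendsto _).comp (hT (M.minus s))).congr fun i => ?_
    change n +ᵥ (digitTime k (T i) +ᵥ pt (M.minus s)) = _
    rw [hy, vadd_vadd, vadd_vadd, add_comm]
  let f : orbitClosure ℤ (pt M) → orbitClosure ℤ (pt M) := fun y =>
    ⟨n y +ᵥ pt ((M.minus (s y)).minus r), by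
      rw [Label.minus_minus]
      exact h.mem_orbitClosure M _ _⟩
  have hf : f ∈ closure (Set.range fun (γ : ℤ) (x : orbitClosure ℤ (pt M)) => γ +ᵥ x) := by
    refine mem_closure_of_tendsto (f := fun i (x : orbitClosure ℤ (pt M)) =>
      digitTime k (T i) +ᵥ x) (b := atTop) ?_ (Eventually.of_forall fun i => ⟨_, rfl⟩)
    exact tendsto_pi_nhds.mpr fun y => tendsto_subtype_rng.mpr (hlim y _ _ (hns y))
  -- The representation of `y` need not be unique; independence of it follows because every choice
  -- computes the limit of the same sequence of shifts of `y`.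
  have hfeq : ∀ (y : orbitClosure ℤ (pt M)) (n : ℤ) (s : FIN),
      (y : ℤ → Bool) = n +ᵥ pt (M.minus s) →
      (f y : ℤ → Bool) = n +ᵥ pt ((M.minus s).minus r) := fun y n s hy =>
    tendsto_nhds_unique (hlim y _ _ (hns y)) (hlim y n s hy)
  refine ⟨⟨f, hf⟩, ?_, hfeq⟩
  refine continuous_iff_ultrafilter.mpr fun y U hU => tendsto_subtype_rng.mpr ?_
  -- The same `n'` and `s'` represent the limit `y` (with `r = 0`) and the limit of the images.
  obtain ⟨n', s', hU'⟩ := h.exists_tendsto_vadd hM U n s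
  have hy : Tendsto (fun z : orbitClosure ℤ (pt M) => (z : ℤ → Bool)) U (𝓝 y) :=
    (continuous_subtype_val.tendsto y).mono_left hU
  have hy' : (y : ℤ → Bool) = n' +ᵥ pt (M.minus s') := by
    refine tendsto_nhds_unique hy (((hU' 0).congr fun z => ?_).trans (by rw [Label.minus_zero]))
    rw [Label.minus_zero, ← hns z]
  rw [hfeq y n' s' hy']
  exact hU' r

/-- The base point of the labeled subshift. -/
def base (pt : Label → ℤ → Bool) (M : Label) : orbitClosure ℤ (pt M) :=
  ⟨pt M, self_mem_orbitClosure ℤ _⟩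

theorem exists_of_apply_base_eq (h : IsLabelCoding b k ell P pt) {M : Label} (hM : M.IsSimple)
    (y : orbitClosure ℤ (pt M)) : ∃ g : Enveloping ℤ (orbitClosure ℤ (pt M)),
      Continuous (g : orbitClosure ℤ (pt M) → orbitClosure ℤ (pt M)) ∧ g (base pt M) = y := by
  obtain ⟨n, s, hns⟩ := h.exists_eq_vadd hM y.2
  obtain ⟨p, hp, hpy⟩ := h.exists_limitElement hM s
  refine ⟨Enveloping.of n * p, (continuous_const_vadd n).comp hp, Subtype.ext ?_⟩
  have h1 := hpy (base pt M) 0 0 (by rw [zero_vadd, Label.minus_zero]; rfl)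
  rw [zero_vadd, Label.minus_zero] at h1
  rw [hns, ← h1]
  rfl

theorem countable_orbitClosure (h : IsLabelCoding b k ell P pt) {M : Label} (hM : M.IsSimple) :
    (orbitClosure ℤ (pt M)).Countable := by
  refine (Set.countable_range fun x : ℤ × FIN => x.1 +ᵥ pt (M.minus x.2)).mono fun y hy => ?_
  obtain ⟨n, s, rfl⟩ := h.exists_eq_vadd hM hy
  exact ⟨(n, s), rfl⟩

theorem isWAP (h : IsLabelCoding b k ell P pt) {M : Label} (hM : M.IsSimple) :
    IsWAP ℤ (orbitClosure ℤ (pt M)) :=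
  Enveloping.continuous_of_transitive (h.exists_of_apply_base_eq hM)

theorem mul_comm (h : IsLabelCoding b k ell P pt) {M : Label} (hM : M.IsSimple)
    (p q : Enveloping ℤ (orbitClosure ℤ (pt M))) : p * q = q * p :=
  Enveloping.mul_comm_of_transitive (h.exists_of_apply_base_eq hM) p q

theorem eq_of_apply_base_eq (h : IsLabelCoding b k ell P pt) {M : Label} (hM : M.IsSimple)
    {p q : Enveloping ℤ (orbitClosure ℤ (pt M))} (hpq : p (base pt M) = q (base pt M)) : p = q :=
  Enveloping.eq_of_apply_eq (h.exists_of_apply_base_eq hM) hpq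

/-- Convergence at the base point is local subtraction of length vectors; continuous elements, which
commute with shifts and with `p`, carry it to all points. -/
theorem tendsto_of_approximates (h : IsLabelCoding b k ell P pt) {M : Label} (hM : M.IsSimple)
    {r : FIN} {p : Enveloping ℤ (orbitClosure ℤ (pt M))}
    (hp : (p (base pt M) : ℤ → Bool) = pt (M.minus r)) {j : ℕ → List ℤ}
    (hj : Approximates ell M r j) (hjP : ∀ i, ∀ a ∈ j i, P a) :
    Tendsto (fun i => (Enveloping.of (time k (j i)) : Enveloping ℤ (orbitClosure ℤ (pt M))))
      atTop (𝓝 p) := by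
  refine Enveloping.tendsto_iff.mpr fun y => tendsto_subtype_rng.mpr ?_
  obtain ⟨g, hg, rfl⟩ := h.exists_of_apply_base_eq hM y
  rw [Enveloping.map_apply_of_continuous hg]
  have hbase : Tendsto (fun i => time k (j i) +ᵥ base pt M) atTop (𝓝 (p (base pt M))) := by
    refine tendsto_subtype_rng.mpr ?_
    rw [hp]
    have h1 := h.tendsto_digitTime_vadd (l := atTop) (T := fun i => (j i).toFinset)
      (N := fun _ => M) (N' := M.minus r)
      (Eventually.of_forall fun i => (hj.1 i).isDigitSet_toFinset)
      (Eventually.of_forall fun i a ha => hjP i a (List.mem_toFinset.mp ha))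
      (fun m => (hj.2.1 m).mono fun i hi a ha => by
        have := hi a (List.mem_toFinset.mp ha)
        rw [Int.abs_eq_natAbs] at this
        exact_mod_cast this)
      (tendsto_const_nhds.congr' (hj.2.2.mono fun i hi => by
        change _ = M.minus (digitLength ell (j i).toFinset)
        rw [(hj.1 i).digitLength_toFinset, hi]))
    refine h1.congr fun i => ?_
    rw [(hj.1 i).digitTime_toFinset]
    rfl
  refine tendsto_subtype_rng.mp ((hg.tendsto _).comp hbase |>.congr fun i => ?_)
  exact Enveloping.map_vadd g _ _

/-- The enveloping semigroup of the subshift of a simple label. -/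
theorem exists_enveloping_hom (h : IsLabelCoding b k ell P pt) {M : Label} (hM : M.IsSimple) :
    ∃ (p : FIN → Enveloping ℤ (orbitClosure ℤ (pt M)))
      (J : Enveloping FIN M.Theta →* Enveloping ℤ (orbitClosure ℤ (pt M))),
      (∀ r, (∀ q : Enveloping ℤ (orbitClosure ℤ (pt M)),
          (q (base pt M) : ℤ → Bool) = pt (M.minus r) ↔ q = p r) ∧
        ∀ j : ℕ → List ℤ, Approximates ell M r j → (∀ i, ∀ a ∈ j i, P a) →
          Tendsto (fun i => (Enveloping.of (time k (j i)) :
            Enveloping ℤ (orbitClosure ℤ (pt M)))) atTop (𝓝 (p r))) ∧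
      Continuous J ∧ Function.Injective J ∧
      (∀ (Q : Enveloping FIN M.Theta) (N : M.Theta),
        ∃ hN : pt N ∈ orbitClosure ℤ (pt M),
          ((J Q) ⟨pt N, hN⟩ : ℤ → Bool) = pt (Q N)) ∧
      (∀ r : FIN, J (Enveloping.of r) = p r) ∧
      (∀ q : Enveloping ℤ (orbitClosure ℤ (pt M)), ∃ (n : ℤ) (r : FIN),
        q = Enveloping.of n * p r ∧ q = Enveloping.of n * J (Enveloping.of r)) := by
  choose p hpc hp using h.exists_limitElement hM
  have hpt : ∀ N : M.Theta, pt N ∈ orbitClosure ℤ (pt M) := by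
    intro N
    obtain ⟨s, hs⟩ := hM.exists_eq_minus N.2
    have := h.mem_orbitClosure M s 0
    rwa [zero_vadd, ← hs] at this
  have hpN : ∀ r (N : M.Theta),
      (p r ⟨pt N, hpt N⟩ : ℤ → Bool) = pt ((N : Label).minus r) := by
    intro r N
    obtain ⟨s, hs⟩ := hM.exists_eq_minus N.2
    have := hp r ⟨pt N, hpt N⟩ 0 s (by rw [zero_vadd, ← hs])
    rwa [zero_vadd, ← hs] at this
  have hpM : ∀ r, (p r (base pt M) : ℤ → Bool) = pt (M.minus r) := fun r =>
    hpN r ⟨M, self_mem_orbitClosure FIN M⟩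
  -- The choice of `r` with `Q = P_r` is arbitrary. It does not affect `J`, since `p r` is
  -- determined by `M - r`, the value of `Q` at `M`.
  choose ρ hρ using hM.exists_eq_of
  have hJN : ∀ (Q : Enveloping FIN M.Theta) (N : M.Theta),
      p (ρ Q) ⟨pt N, hpt N⟩ = ⟨pt (Q N), hpt (Q N)⟩ := by
    intro Q N
    refine Subtype.ext ((hpN _ N).trans ?_)
    conv_rhs => rw [hρ Q]
    rfl
  have hJM : ∀ Q : Enveloping FIN M.Theta, p (ρ Q) (base pt M) =
      ⟨pt (Q ⟨M, self_mem_orbitClosure FIN M⟩), hpt _⟩ := fun Q => hJN Q ⟨M, self_mem_orbitClosure FIN M⟩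
  let J : Enveloping FIN M.Theta →* Enveloping ℤ (orbitClosure ℤ (pt M)) :=
    { toFun := fun Q => p (ρ Q)
      map_one' := h.eq_of_apply_base_eq hM (hJM 1)
      map_mul' := fun Q Q' => h.eq_of_apply_base_eq hM (by
        refine (hJM (Q * Q')).trans ((hJN Q _).symm.trans ?_)
        exact congrArg (p (ρ Q)) (hJM Q').symm) }
  have hJof : ∀ r, J (Enveloping.of r) = p r := fun r =>
    h.eq_of_apply_base_eq hM ((hJM _).trans (Subtype.ext (hpM r).symm))
  have hform : ∀ q : Enveloping ℤ (orbitClosure ℤ (pt M)), ∃ (n : ℤ) (r : FIN),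
      q = Enveloping.of n * p r := by
    intro q
    obtain ⟨n, r, hnr⟩ := h.exists_eq_vadd hM (q (base pt M)).2
    refine ⟨n, r, h.eq_of_apply_base_eq hM (Subtype.ext ?_)⟩
    rw [hnr, ← hpM]
    rfl
  refine ⟨p, J, fun r => ⟨fun q => ⟨fun hq => ?_, fun hq => hq ▸ hpM r⟩,
    fun j hj hjP => h.tendsto_of_approximates hM (hpM r) hj hjP⟩, ?_, ?_,
    fun Q N => ⟨hpt N, congrArg Subtype.val (hJN Q N)⟩, hJof, fun q => ?_⟩
  · exact h.eq_of_apply_base_eq hM (Subtype.ext (hq.trans (hpM r).symm))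
  · refine Enveloping.continuous_iff.mpr fun y => ?_
    obtain ⟨g, hg, rfl⟩ := h.exists_of_apply_base_eq hM y
    -- Commuting with `g` reduces the evaluation at an arbitrary point to evaluation of `Q` at `M`,
    -- followed by the continuous maps `pt` and `g`.
    have heq : (fun Q => J Q (g (base pt M))) =
        fun Q => g ⟨pt (Q ⟨M, self_mem_orbitClosure FIN M⟩), hpt _⟩ := by
      funext Q
      rw [Enveloping.map_apply_of_continuous hg]
      exact congrArg _ (hJM Q)
    rw [heq]
    refine hg.comp (Continuous.subtype_mk (h.continuous.comp ?_) _)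
    exact continuous_subtype_val.comp (Enveloping.continuous_eval _)
  · intro Q Q' hQ
    refine Enveloping.eq_of_apply_eq hM.exists_of_apply_eq (Subtype.ext (h.injective ?_))
    have h1 := (hJM Q).symm.trans ((congrArg (fun p => p (base pt M)) hQ).trans (hJM Q'))
    exact congrArg Subtype.val h1
  · obtain ⟨n, r, hq⟩ := hform q
    exact ⟨n, r, hq, by rw [hJof, ← hq]⟩

end IsLabelCoding

/-! ### The two codings -/

theorem boolIndicator_eq_true_iff {s : Set ℤ} {t : ℤ} : s.boolIndicator t = true ↔ t ∈ s :=
  (Set.mem_iff_boolIndicator s t).symm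

theorem mem_A_iff {k : ℤ → ℤ} {ell : ℕ+ → ℕ+} {N : Label} {t : ℤ} :
    t ∈ A k ell N ↔ ∃ E, IsDigitSet E ∧ t = digitTime k E ∧ digitLength ell E ∈ N := by
  constructor
  · rintro ⟨j, hj, ht, hjN⟩
    refine ⟨j.toFinset, hj.isDigitSet_toFinset, ?_, ?_⟩
    · rw [hj.digitTime_toFinset, ht]
    · rwa [hj.digitLength_toFinset]
  · rintro ⟨E, hE, ht, hEN⟩
    obtain ⟨j, hj, rfl⟩ := hE.exists_isExpansion
    exact ⟨j, hj, by rw [ht, hj.digitTime_toFinset], by rwa [← hj.digitLength_toFinset]⟩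

theorem isLabelCoding_labelPoint {b : ℕ} {k : ℤ → ℤ} {ell : ℕ+ → ℕ+} (hb : 3 ≤ b)
    (hk : IsExpandingFunction b k) (hk1 : 0 < k 1) (hell : IsSupportMap ell) :
    IsLabelCoding b k ell (fun _ => True) (labelPoint k ell) where
  three_le := hb
  expanding := hk
  map_one_pos := hk1
  infinite := hell.1
  of_pos _ _ := trivial
  apply_iff N t := by
    rw [labelPoint, boolIndicator_eq_true_iff, mem_A_iff]
    simp

theorem mem_IPplus_iff {b : ℕ} {k : ℤ → ℤ} (hb : 3 ≤ b) (hk : IsExpandingFunction b k)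
    (hk1 : 0 < k 1) {t : ℤ} :
    t ∈ IPplus k ↔ ∃ E : Finset ℤ, (∀ a ∈ E, 0 < a) ∧ t = digitTime k E := by
  classical
  have hinj : Set.InjOn k {n | 0 ≤ n} := by
    intro m hm n hn hmn
    lift m to ℕ using hm
    lift n to ℕ using hn
    rw [(hk.strictMono_nat hb hk1).injective hmn]
  constructor
  · rintro ⟨F, hF, rfl⟩
    obtain ⟨E, hE, rfl⟩ := Finset.subset_set_image_iff.mp hF
    -- Sums from `k(ℤ₊)` may use the index 0, which is not a digit; it is dropped at no cost because
    -- `k 0 = 0`.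
    refine ⟨E.erase 0, fun a ha => ?_, ?_⟩
    · have h1 := hE (Finset.mem_of_mem_erase ha)
      exact lt_of_le_of_ne h1 (Finset.ne_of_mem_erase ha).symm
    · rw [digitTime, Finset.sum_erase E hk.map_zero]
      exact Finset.sum_image (hinj.mono hE)
  · rintro ⟨E, hE, rfl⟩
    have hE0 : (E : Set ℤ) ⊆ {n | 0 ≤ n} := fun a ha => (hE a ha).le
    refine ⟨E.image k, ?_, (Finset.sum_image (f := fun a => a) (hinj.mono hE0)).symm⟩
    rw [Finset.coe_image]
    exact Set.image_mono hE0

theorem isLabelCoding_labelPointPlus {b : ℕ} {k : ℤ → ℤ} {ell : ℕ+ → ℕ+} (hb : 3 ≤ b)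
    (hk : IsExpandingFunction b k) (hk1 : 0 < k 1) (hell : IsSupportMap ell) :
    IsLabelCoding b k ell (fun a => 0 < a) (labelPointPlus k ell) where
  three_le := hb
  expanding := hk
  map_one_pos := hk1
  infinite := hell.1
  of_pos _ ha := ha
  apply_iff N t := by
    rw [labelPointPlus, boolIndicator_eq_true_iff, Aplus, Set.mem_inter_iff, mem_A_iff,
      mem_IPplus_iff hb hk hk1]
    constructor
    · rintro ⟨⟨E, hE, rfl, hEN⟩, F, hF, hEF⟩
      -- Uniqueness of expansions makes the expansion with length vector in `N` the positive one.
      obtain rfl := digitTime_injOn hk hb hk1 hE (IsDigitSet.of_pos hF) hEF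
      exact ⟨E, hE, hF, rfl, hEN⟩
    · rintro ⟨E, hE, hE0, rfl, hEN⟩
      exact ⟨⟨E, hE, rfl, hEN⟩, E, hE0, rfl⟩

end LabeledSubshift

theorem theorem5 (b : ℕ) (hb : 3 ≤ b) (k : ℤ → ℤ) (hk : IsExpandingFunction b k)
    (hk1 : (b : ℤ) + 1 ≤ k 1) (ell : ℕ+ → ℕ+) (hell : IsSupportMap ell)
    (M : Label) (hM : M.IsSimple) :
    -- both subshifts are countable and WAP
    (labelShift k ell M).Countable ∧ IsWAP ℤ (labelShift k ell M) ∧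
    (labelShiftPlus k ell M).Countable ∧ IsWAP ℤ (labelShiftPlus k ell M) ∧
    -- the three enveloping semigroups are abelian
    (∀ p q : Enveloping FIN M.Theta, p * q = q * p) ∧
    (∀ p q : Enveloping ℤ (labelShift k ell M), p * q = q * p) ∧
    (∀ p q : Enveloping ℤ (labelShiftPlus k ell M), p * q = q * p) ∧
    -- and act by continuous maps (for the two subshifts this is the WAP property above)
    (∀ p : Enveloping FIN M.Theta, Continuous (p : M.Theta → M.Theta)) ∧
    -- the elements `p_r`, the homomorphism `J` and the form of the elements for `X(M)`
    (∃ (p : FIN → Enveloping ℤ (labelShift k ell M))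
        (J : Enveloping FIN M.Theta →* Enveloping ℤ (labelShift k ell M)),
      (∀ r, IsLimitElement k ell M r (p r)) ∧
      Continuous J ∧ Function.Injective J ∧
      (∀ (Q : Enveloping FIN M.Theta) (N : M.Theta),
        ∃ hN : labelPoint k ell N ∈ labelShift k ell M,
          ((J Q) ⟨labelPoint k ell N, hN⟩ : ℤ → Bool) = labelPoint k ell (Q N)) ∧
      (∀ r : FIN, J (Enveloping.of r) = p r) ∧
      (∀ q : Enveloping ℤ (labelShift k ell M), ∃ (n : ℤ) (r : FIN),
        q = Enveloping.of n * p r ∧ q = Enveloping.of n * J (Enveloping.of r))) ∧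
    -- the elements `p_r`, the homomorphism `J` and the form of the elements for `X₊(M)`
    (∃ (p : FIN → Enveloping ℤ (labelShiftPlus k ell M))
        (J : Enveloping FIN M.Theta →* Enveloping ℤ (labelShiftPlus k ell M)),
      (∀ r, IsLimitElementPlus k ell M r (p r)) ∧
      Continuous J ∧ Function.Injective J ∧
      (∀ (Q : Enveloping FIN M.Theta) (N : M.Theta),
        ∃ hN : labelPointPlus k ell N ∈ labelShiftPlus k ell M,
          ((J Q) ⟨labelPointPlus k ell N, hN⟩ : ℤ → Bool) = labelPointPlus k ell (Q N)) ∧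
      (∀ r : FIN, J (Enveloping.of r) = p r) ∧
      (∀ q : Enveloping ℤ (labelShiftPlus k ell M), ∃ (n : ℤ) (r : FIN),
        q = Enveloping.of n * p r ∧ q = Enveloping.of n * J (Enveloping.of r))) := by
  have hk1' : 0 < k 1 := by lia
  have h := isLabelCoding_labelPoint hb hk hk1' hell
  have hplus := isLabelCoding_labelPointPlus hb hk hk1' hell
  refine ⟨h.countable_orbitClosure hM, h.isWAP hM, hplus.countable_orbitClosure hM,
    hplus.isWAP hM, Enveloping.mul_comm_of_transitive hM.exists_of_apply_eq, h.mul_comm hM,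
    hplus.mul_comm hM, Enveloping.continuous_of_transitive hM.exists_of_apply_eq, ?_,
    hplus.exists_enveloping_hom hM⟩
  obtain ⟨p, J, hp, hJ⟩ := h.exists_enveloping_hom hM
  exact ⟨p, J, fun r => ⟨(hp r).1, fun j hj => (hp r).2 j hj fun _ _ _ => trivial⟩, hJ⟩
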